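/- Let $c^2$ be a real constant, let $U\subset\mathbb{C}$ be a domain, and let $\upsilon,\varphi:U\to\mathbb{R}$, $Q:U\to\mathbb{C}$ and $h:J\to\mathbb{R}$, $J=\varphi(U)$, be smooth, with $\varphi_z\neq0$ and $Q\neq 0$ on $U$ and $h'\ne0$ on $J$. Suppose that the mean curvature reduces to a function of one variable, $H(z,\bar z)=h(\xi)$ with $\xi=\varphi(z,\bar z)$, in the Gauss–Codazzi equations $$\upsilon_{z\bar z}+\tfrac12(H^2-c^2)e^{\upsilon}-2|Q|^2e^{-\upsilon}=0,\qquad Q_{\bar z}-\tfrac12H_ze^{\upsilon}=0,\qquad \overline{Q}_z-\tfrac12H_{\bar z}e^{\upsilon}=0 .$$ Then on $U$ one has $\overline{Q}_z\varphi_z-Q_{\bar z}\varphi_{\bar z}=0$ and, at $\xi=\varphi(z,\bar z)$, $$(\log h')''+F_1h'+F_2\frac{h''}{h'}+F_3\frac{h^2-c^2}{h'}+F_4=0,\qquad(\ast)$$ $$F_1=\frac{Q\overline Q}{Q_{\bar z}\varphi_{\bar z}},\quad F_2=\frac{\varphi_{z\bar z}}{\varphi_z\varphi_{\bar z}},\quad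 F_3=-\frac{Q_{\bar z}}{\varphi_z^2\varphi_{\bar z}},\quad F_4=\frac{Q_{\bar z\bar z}Q_{z\bar z}}{Q_{\bar z}^2\varphi_z\varphi_{\bar z}}-\frac{Q_{z\bar z\bar z}}{Q_{\bar z}\varphi_z\varphi_{\bar z}}-\frac{\varphi_{z\bar z}\varphi_{zz}}{\varphi_z^3\varphi_{\bar z}}+\frac{\varphi_{zz\bar z}}{\varphi_z^2\varphi_{\bar z}} .$$ Suppose moreover that $(\ast)$ is an ODE, i.e. that $F_1,\dots,F_4$ are smooth real functions of $\xi\in J$ alone. Then $F_1$ does not vanish on $J$. Put $X(\xi)=\int_{\xi_1}^{\xi}\frac{F_1(t)}2\,dt$, with any $\xi_1\in J$. The ODE $(\ast)$ is said to pass the Painlevé test if for each $\xi_0\in J$, with $\chi=\xi-\xi_0$ and the coefficients $F_j$ replaced by their Taylor series at $\xi_0$, it has formal Laurent series solutions with complex coefficients as follows: (i) for all $u_1,u_2\in\mathbb{C}$ a solution $h=u_0\chi^{-1}+u_1+u_2\chi+\cdots$ with $u_0\ne0$; (ii) for all $g_0,g_2\in\mathbb{C}$ with $g_0\neq0$ a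 solution $h$ such that $1/h'=g_0\chi^{-2}+g_1\chi^{-1}+g_2+\cdots$. Then $(\ast)$ passes the Painlevé test if and only if, with $$G_4=\Big(\frac2{F_1}\Big)^2\big[F_4+(\log F_1)''-((\log F_1)')^2\big],$$ the following holds on $J$: $$F_2=-\frac{F_1'}{F_1},\qquad F_3=\Big(\frac{F_1}2\Big)^3G_4,$$ and there are constants $a\in\mathbb{C}$ with $a^2\in\mathbb{R}$ and $x_0\in\mathbb{R}$ such that $$G_4=2(4a)^2\Big[1-\coth^2\big(4a(X-x_0)\big)\Big],\qquad \sinh\big(4a(X-x_0)\big)\neq0 .$$ In that case, for these constants, the change of independent variable $x=X(\xi)$ turns $(\ast)$ into exactly Bonnet's ODE: for every complex-valued $k\in C^3(X(J))$ with nonvanishing derivative, the left-hand side of $(\ast)$ for $h=k\circ X$ equals $(F_1/2)^2$ times $$(\log k')''+2k'-2\Big(\frac{4a}{\sinh 4a(x-x_0)}\Big)^2\,\frac{k'+k^2-c^2}{k'}\qquad(x=X(\xi)).$$ For $a=0$ the expressions $\frac{4a}{\sinh 4a(x-x_0)}$ and $2(4a)^2[1-\coth^2 4a(x-x_0)]$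 mean their limits $\frac1{x-x_0}$ and $-\frac{2}{(x-x_0)^2}$, and the condition $\sinh(\cdots)\neq0$ means $X\ne x_0$. -/

import Mathlib

open scoped ContDiff LaurentSeries

noncomputable section

namespace BonnetSurface

/-! ### Gauss-Codazzi equations in conformal coordinates -/

/-- Wirtinger derivative `∂f/∂z = (∂f/∂x - i ∂f/∂y)/2`. -/
def dz (f : ℂ → ℂ) (z : ℂ) : ℂ :=
  (fderiv ℝ f z 1 - Complex.I * fderiv ℝ f z Complex.I) / 2

/-- Wirtinger derivative `∂f/∂z̄ = (∂f/∂x + i ∂f/∂y)/2`. -/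
def dzbar (f : ℂ → ℂ) (z : ℂ) : ℂ :=
  (fderiv ℝ f z 1 + Complex.I * fderiv ℝ f z Complex.I) / 2

/-- A real function regarded as a complex valued one. -/
def toC {α : Type*} (f : α → ℝ) : α → ℂ := fun x => (f x : ℂ)

/-- The Gauss-Codazzi equations on `U` for the metric `e^υ dz dz̄`, the mean curvature `H` and the
Hopf coefficient `Q`; the real number `C` stands for the constant written `c²`. -/
structure GaussCodazzi (C : ℝ) (υ H : ℂ → ℝ) (Q : ℂ → ℂ) (U : Set ℂ) : Prop where
  gauss : ∀ z ∈ U, dz (dzbar (toC υ)) z + (1 / 2) * ((H z : ℂ) ^ 2 - C) * Complex.exp (υ z)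
    - 2 * (‖Q z‖ : ℂ) ^ 2 * Complex.exp (-υ z) = 0
  codazzi₁ : ∀ z ∈ U, dzbar Q z - (1 / 2) * dz (toC H) z * Complex.exp (υ z) = 0
  codazzi₂ : ∀ z ∈ U,
    dz (fun w => star (Q w)) z - (1 / 2) * dzbar (toC H) z * Complex.exp (υ z) = 0

/-! ### Coefficients of the reduced Gauss equation -/

/-- `F₁ = Q Q̄ / (Q_z̄ φ_z̄)` -/
def coeffF₁ (Q : ℂ → ℂ) (φ : ℂ → ℝ) (z : ℂ) : ℂ :=
  Q z * star (Q z) / (dzbar Q z * dzbar (toC φ) z)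

/-- `F₂ = φ_zz̄ / (φ_z φ_z̄)` -/
def coeffF₂ (φ : ℂ → ℝ) (z : ℂ) : ℂ :=
  dz (dzbar (toC φ)) z / (dz (toC φ) z * dzbar (toC φ) z)

/-- `F₃ = - Q_z̄ / (φ_z² φ_z̄)` -/
def coeffF₃ (Q : ℂ → ℂ) (φ : ℂ → ℝ) (z : ℂ) : ℂ :=
  -(dzbar Q z / (dz (toC φ) z ^ 2 * dzbar (toC φ) z))

/-- `F₄ = Q_z̄z̄ Q_zz̄ / (Q_z̄² φ_z φ_z̄) - Q_zz̄z̄ / (Q_z̄ φ_z φ_z̄)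
- φ_zz̄ φ_zz / (φ_z³ φ_z̄) + φ_zzz̄ / (φ_z² φ_z̄)` -/
def coeffF₄ (Q : ℂ → ℂ) (φ : ℂ → ℝ) (z : ℂ) : ℂ :=
  dzbar (dzbar Q) z * dz (dzbar Q) z / (dzbar Q z ^ 2 * dz (toC φ) z * dzbar (toC φ) z)
  - dz (dzbar (dzbar Q)) z / (dzbar Q z * dz (toC φ) z * dzbar (toC φ) z)
  - dz (dzbar (toC φ)) z * dz (dz (toC φ)) z / (dz (toC φ) z ^ 3 * dzbar (toC φ) z)
  + dz (dz (dzbar (toC φ))) z / (dz (toC φ) z ^ 2 * dzbar (toC φ) z)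

/-- Left-hand side `(log h')'' + f₁ h' + f₂ h''/h' + f₃ (h² - c²)/h' + f₄` of the reduced Gauss
equation at the point `ξ`, where the coefficients take the values `f₁, …, f₄`;
`logDeriv k = k'/k`. -/
def reducedLHS (C : ℝ) (f₁ f₂ f₃ f₄ : ℂ) (h : ℝ → ℂ) (ξ : ℝ) : ℂ :=
  deriv (logDeriv (deriv h)) ξ + f₁ * deriv h ξ + f₂ * (deriv (deriv h) ξ / deriv h ξ)
    + f₃ * ((h ξ ^ 2 - C) / deriv h ξ) + f₄

/-! ### The Painlevé test -/

/-- Taylor series of `F` at `ξ₀`, in the local variable `χ = ξ - ξ₀`, as a formal Laurent series. -/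
def taylor (F : ℝ → ℝ) (ξ₀ : ℝ) : ℂ⸨X⸩ :=
  ((PowerSeries.mk fun n => ((iteratedDeriv n F ξ₀ / (n.factorial : ℝ) : ℝ) : ℂ) :
    PowerSeries ℂ) : ℂ⸨X⸩)

/-- `d/dχ` on formal Laurent series in `χ`. -/
def D (h : ℂ⸨X⸩) : ℂ⸨X⸩ := LaurentSeries.derivative ℂ h

/-- The formal Laurent series `h` in `χ = ξ - ξ₀` is a nonconstant solution of
`(log h')'' + F₁ h' + F₂ h''/h' + F₃ (h² - c²)/h' + F₄ = 0`. -/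
def IsLaurentSolution (C : ℝ) (F₁ F₂ F₃ F₄ : ℝ → ℝ) (ξ₀ : ℝ) (h : ℂ⸨X⸩) : Prop :=
  D h ≠ 0 ∧
  D (D (D h) / D h) + taylor F₁ ξ₀ * D h + taylor F₂ ξ₀ * (D (D h) / D h)
    + taylor F₃ ξ₀ * ((h ^ 2 - HahnSeries.C (C : ℂ)) / D h) + taylor F₄ ξ₀ = 0

/-- The Painlevé test on `J` for the equation with coefficients `F₁, …, F₄`: existence of the
Laurent series of `h` and of `1/h'` that represent the general solution, i.e. that contain three
arbitrary constants. At every location `ξ₀` there is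
* a solution `h = u₀ χ⁻¹ + u₁ + u₂ χ + ⋯` with a simple pole (Fuchs indices `-1, 1, 2`), for all
  values of `u₁, u₂`;
* a solution for which `1/h' = g₀ χ⁻² + g₁ χ⁻¹ + g₂ + ⋯` has a double pole (Fuchs indices
  `-1, 0, 2`), for all values of `g₀ ≠ 0` and `g₂`. -/
def PassesPainleveTest (C : ℝ) (F₁ F₂ F₃ F₄ : ℝ → ℝ) (J : Set ℝ) : Prop :=
  ∀ ξ₀ ∈ J,
    (∀ u₁ u₂ : ℂ, ∃ h : ℂ⸨X⸩, IsLaurentSolution C F₁ F₂ F₃ F₄ ξ₀ h ∧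
      h.order = -1 ∧ h.coeff 0 = u₁ ∧ h.coeff 1 = u₂) ∧
    (∀ g₀ g₂ : ℂ, g₀ ≠ 0 → ∃ h : ℂ⸨X⸩, IsLaurentSolution C F₁ F₂ F₃ F₄ ξ₀ h ∧
      ((D h)⁻¹).order = -2 ∧ ((D h)⁻¹).coeff (-2) = g₀ ∧ ((D h)⁻¹).coeff 0 = g₂)

/-! ### Bonnet's equation -/

/-- `G₄ = (2/F₁)² [F₄ + (log F₁)'' - ((log F₁)')²]` -/
def G₄ (F₁ F₄ : ℝ → ℝ) (ξ : ℝ) : ℝ :=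
  (2 / F₁ ξ) ^ 2 * (F₄ ξ + deriv (logDeriv F₁) ξ - (logDeriv F₁ ξ) ^ 2)

/-- `sinh (4 a x) / (4 a)`, read as its limit `x` for `a = 0`. -/
def sinhScaled (a : ℂ) (x : ℝ) : ℂ :=
  if a = 0 then (x : ℂ) else Complex.sinh (4 * a * x) / (4 * a)

/-- `2 (4a)² [1 - coth² (4 a x)]`, read as its limit `-2/x²` for `a = 0`. -/
def bonnetG₄ (a : ℂ) (x : ℝ) : ℂ :=
  if a = 0 then -2 / (x : ℂ) ^ 2
  else 2 * (4 * a) ^ 2 * (1 - (Complex.cosh (4 * a * x) / Complex.sinh (4 * a * x)) ^ 2)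

/-- Left-hand side of Bonnet's equation
`(log h')'' + 2 h' - 2 (4a / sinh 4a(x - x₀))² (h' + h² - c²)/h' = 0`, where
`4a / sinh 4a(x - x₀)` is read as `1/(x - x₀)` for `a = 0`. -/
def bonnetLHS (C : ℝ) (a : ℂ) (x₀ : ℝ) (h : ℝ → ℂ) (x : ℝ) : ℂ :=
  deriv (logDeriv (deriv h)) x + 2 * deriv h x
    - 2 * (1 / sinhScaled a (x - x₀)) ^ 2 * ((deriv h x + h x ^ 2 - C) / deriv h x)

end BonnetSurface

end

/-! Reduction. The first Codazzi equation reads `Q_z̄ = h' φ_z e^υ / 2`. Its logarithmic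
`z̄`-derivative expresses `υ_z̄` through `Q`, `φ` and `h`; one more `z`-derivative, together with
`e^υ = 2 Q_z̄ / (h' φ_z)`, turns the Gauss equation, up to the factor `-φ_z φ_z̄`, into the reduced
equation. In the product `F₁ F₃` the factor `Q_z̄` cancels and leaves `-|Q|²/|φ_z|⁴ < 0`. Hence `F₁`
and `F₃` never vanish, and `G₄ < 0` once `F₃ = (F₁/2)³ G₄`.

Painlevé test. Write `θ = χ d/dχ`. For `h = χ⁻¹ u` the order-`n` equation is linear in the
coefficient `uₙ` with factor `-u₀ (n-1)(n-2)(n+1)`. So `u₁`, `u₂` are free exactly when the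
equations of orders 1 and 2 hold identically: `F₁' = -F₁ F₂` and `F₁ F₄ = F₁'' + 2 F₁ F₂' + 2 F₃`.
For `h = e + χ³ s` the factor is `v₀ (n+3)(n-2)(n+1)`, where `v₀` is the leading coefficient of `χ⁻²
h'`; order 0 fixes `e²`, order 1 fixes the next coefficient, and only order 2 imposes a condition,
`ZeroCondition`. None of the three conditions involves the free constants, so one solution of each
kind forces them; conversely they let the recursion run (`exists_formal_solution`,
`passesPainleveTest_iff`).

Integration. On all of `J` the two pole conditions amount to the formulas for `F₂` and `F₃`
(`poleCondition_iff`). Given these, put `q = -2/G₄ > 0` and `dx = F₁/2 dξ`. Then `ZeroCondition` is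
`q_x² - q q_xx = 2 q` (`zeroCondition_iff`). It follows that `(q_xx - 2)/q` is a constant `4 l`, so
`s = √q` satisfies `s_x² = 1 + l s²` and `s_xx = l s`. Thus `s = ± sinh(4a(x - x₀))/(4a)` with
`(4a)² = l`, where `a` is real, zero or imaginary according to the sign of `l`
(`exists_eq_sinhScaled_sq`). With these formulas the chain rule gives Bonnet's equation
(`reducedLHS_comp`). -/

noncomputable section

namespace BonnetSurface

open scoped PowerSeries

/-! ### Formal power series -/

/-- The Euler derivation `θ = χ d/dχ` on formal power series. -/
def euler : Derivation ℂ ℂ⟦X⟧ ℂ⟦X⟧ := (PowerSeries.X : ℂ⟦X⟧) • PowerSeries.derivative ℂ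

lemma coeff_euler (f : ℂ⟦X⟧) (n : ℕ) :
    PowerSeries.coeff n (euler f) = n * PowerSeries.coeff n f := by
  have : euler f = PowerSeries.X * PowerSeries.derivative ℂ f := rfl
  rw [this]
  cases n with
  | zero => simp
  | succ n => rw [PowerSeries.coeff_succ_X_mul, PowerSeries.coeff_derivative]; push_cast; ring

lemma euler_mul (f g : ℂ⟦X⟧) : euler (f * g) = f * euler g + g * euler f := by
  simp [smul_eq_mul]

lemma constantCoeff_euler (f : ℂ⟦X⟧) : PowerSeries.constantCoeff (euler f) = 0 := by
  rw [← PowerSeries.coeff_zero_eq_constantCoeff_apply, coeff_euler]; simp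

lemma euler_X_pow_mul (n : ℕ) (f : ℂ⟦X⟧) :
    euler (PowerSeries.X ^ n * f) = PowerSeries.X ^ n * ((n : ℂ⟦X⟧) * f + euler f) := by
  ext m
  have hC : (n : ℂ⟦X⟧) = PowerSeries.C (n : ℂ) := by simp
  rw [coeff_euler, PowerSeries.coeff_X_pow_mul', PowerSeries.coeff_X_pow_mul']
  split_ifs with h
  · rw [map_add, coeff_euler, hC, PowerSeries.coeff_C_mul, Nat.cast_sub h]; ring
  · simp

/-- `b = a + δ χⁿ + O(χⁿ⁺¹)`. -/
def AgreesTo (n : ℕ) (a b : ℂ⟦X⟧) (δ : ℂ) : Prop :=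
  ∃ e : ℂ⟦X⟧, b = a + PowerSeries.X ^ n * e ∧ PowerSeries.constantCoeff e = δ

namespace AgreesTo

variable {n : ℕ} {a b a' b' : ℂ⟦X⟧} {δ ε : ℂ}

lemma refl (n : ℕ) (a : ℂ⟦X⟧) : AgreesTo n a a 0 := ⟨0, by simp, by simp⟩

lemma add (h : AgreesTo n a b δ) (h' : AgreesTo n a' b' ε) :
    AgreesTo n (a + a') (b + b') (δ + ε) := by
  obtain ⟨e, rfl, rfl⟩ := h
  obtain ⟨e', rfl, rfl⟩ := h'
  exact ⟨e + e', by ring, by simp⟩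

lemma sub (h : AgreesTo n a b δ) (h' : AgreesTo n a' b' ε) :
    AgreesTo n (a - a') (b - b') (δ - ε) := by
  obtain ⟨e, rfl, rfl⟩ := h
  obtain ⟨e', rfl, rfl⟩ := h'
  exact ⟨e - e', by ring, by simp⟩

/-- Leibniz rule for the first perturbed coefficient. The second-order term `χ²ⁿ e e'` reaches order
`n` only when `n = 0`, hence `n ≠ 0`. -/
lemma mul (hn : n ≠ 0) (h : AgreesTo n a b δ) (h' : AgreesTo n a' b' ε) :
    AgreesTo n (a * a') (b * b')
      (PowerSeries.constantCoeff a * ε + δ * PowerSeries.constantCoeff a') := by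
  obtain ⟨e, rfl, rfl⟩ := h
  obtain ⟨e', rfl, rfl⟩ := h'
  exact ⟨a * e' + e * a' + PowerSeries.X ^ n * e * e', by ring, by simp [hn]⟩

lemma const_mul (c : ℂ⟦X⟧) (h : AgreesTo n a b δ) :
    AgreesTo n (c * a) (c * b) (PowerSeries.constantCoeff c * δ) := by
  obtain ⟨e, rfl, rfl⟩ := h
  exact ⟨c * e, by ring, by simp⟩

lemma euler (h : AgreesTo n a b δ) :
    AgreesTo n (BonnetSurface.euler a) (BonnetSurface.euler b) (n * δ) := by
  obtain ⟨e, rfl, rfl⟩ := h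
  exact ⟨(n : ℂ⟦X⟧) * e + BonnetSurface.euler e, by rw [map_add, euler_X_pow_mul],
    by simp [constantCoeff_euler]⟩

lemma coeff_lt (h : AgreesTo n a b δ) {m : ℕ} (hm : m < n) :
    PowerSeries.coeff m b = PowerSeries.coeff m a := by
  obtain ⟨e, rfl, rfl⟩ := h
  simp [PowerSeries.coeff_X_pow_mul', hm]

lemma coeff_self (h : AgreesTo n a b δ) :
    PowerSeries.coeff n b = PowerSeries.coeff n a + δ := by
  obtain ⟨e, rfl, rfl⟩ := h
  simp [PowerSeries.coeff_X_pow_mul']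

lemma congr (h : AgreesTo n a b δ) (hδ : δ = ε) : AgreesTo n a b ε := hδ ▸ h

end AgreesTo

/-- Formal solution of `Φ u = 0` by recursion on the coefficients: it exists if the equation holds
to order `N` and its linearization in the coefficient of `χⁿ` is invertible for `n ≥ N`. -/
lemma exists_formal_solution (Φ : ℂ⟦X⟧ → ℂ⟦X⟧) (N : ℕ) (v : ℂ⟦X⟧) (κ : ℕ → ℂ)
    (hκ : ∀ n, N ≤ n → κ n ≠ 0)
    (hv : ∀ m < N, PowerSeries.coeff m (Φ v) = 0)
    (hΦ : ∀ n, N ≤ n → ∀ u d : ℂ⟦X⟧,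
      (∀ m < N, PowerSeries.coeff m u = PowerSeries.coeff m v) →
      AgreesTo n (Φ u) (Φ (u + PowerSeries.X ^ n * d)) (κ n * PowerSeries.constantCoeff d)) :
    ∃ u : ℂ⟦X⟧, (∀ m < N, PowerSeries.coeff m u = PowerSeries.coeff m v) ∧ Φ u = 0 := by
  -- One Newton step: the correction at `χⁿ` cancels the residual of order `n` and leaves all lower
  -- orders untouched.
  let step : ℕ → ℂ⟦X⟧ → ℂ⟦X⟧ := fun n u =>
    u + PowerSeries.X ^ n * PowerSeries.C (-(PowerSeries.coeff n (Φ u)) / κ n)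
  let w : ℕ → ℂ⟦X⟧ := fun i => Nat.rec v (fun i u => step (N + i) u) i
  have hw0 : w 0 = v := rfl
  have hws : ∀ i, w (i + 1) = step (N + i) (w i) := fun i => rfl
  have hcoeff : ∀ i m, m < N + i → PowerSeries.coeff m (w (i + 1)) = PowerSeries.coeff m (w i) := by
    intro i m hm
    rw [hws, map_add, PowerSeries.coeff_X_pow_mul', if_neg (by lia), add_zero]
  have hcoeff' : ∀ i j m, m < N + i →
      PowerSeries.coeff m (w (i + j)) = PowerSeries.coeff m (w i) := by
    intro i j m hm
    induction j with
    | zero => rfl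
    | succ j ih => rw [← add_assoc, hcoeff _ _ (by lia), ih]
  have hwv : ∀ i, ∀ m < N, PowerSeries.coeff m (w i) = PowerSeries.coeff m v := by
    intro i m hm
    rw [← hw0, ← hcoeff' 0 i m (by simpa using hm), zero_add]
  have hsol : ∀ i, ∀ m < N + i, PowerSeries.coeff m (Φ (w i)) = 0 := by
    intro i
    induction i with
    | zero => exact fun m hm => hv m (by simpa using hm)
    | succ i ih =>
      intro m hm
      have h := hΦ (N + i) (by lia) (w i)
        (PowerSeries.C (-(PowerSeries.coeff (N + i) (Φ (w i))) / κ (N + i))) (hwv i)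
      rw [hws]
      rcases Nat.lt_succ_iff_lt_or_eq.mp (show m < (N + i).succ by lia) with h1 | rfl
      · exact (h.coeff_lt h1).trans (ih m h1)
      · refine h.coeff_self.trans ?_
        have := hκ (N + i) (by lia)
        rw [PowerSeries.constantCoeff_C]
        field_simp
        ring
  let u : ℂ⟦X⟧ := PowerSeries.mk fun m => PowerSeries.coeff m (w (m + 1))
  have hu : ∀ i, ∀ m < N + i, PowerSeries.coeff m u = PowerSeries.coeff m (w i) := by
    intro i m hm
    rw [PowerSeries.coeff_mk]
    rcases le_total i (m + 1) with h | h
    · obtain ⟨j, hj⟩ := Nat.exists_eq_add_of_le h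
      rw [hj, hcoeff' _ _ _ hm]
    · obtain ⟨j, hj⟩ := Nat.exists_eq_add_of_le h
      rw [hj, hcoeff' _ _ _ (by lia)]
  refine ⟨u, fun m hm => by simpa [hw0] using hu 0 m (by simpa using hm), ?_⟩
  ext m
  -- The limit and the iterate `w (m + 1)` agree below order `N + m + 1`, hence so do their images
  -- under `Φ`; this covers order `m`.
  have hdvd : PowerSeries.X ^ (N + (m + 1)) ∣ u - w (m + 1) := by
    rw [PowerSeries.X_pow_dvd_iff]
    intro k hk
    rw [map_sub, hu _ _ hk, sub_self]
  obtain ⟨d, hd⟩ := hdvd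
  have : u = w (m + 1) + PowerSeries.X ^ (N + (m + 1)) * d := by rw [← hd]; ring
  have hagree := hΦ (N + (m + 1)) (by lia) (w (m + 1)) d (hwv (m + 1))
  rw [this, hagree.coeff_lt (by lia), hsol (m + 1) m (by lia), map_zero]

/-! ### Laurent series of given order -/

/-- The Laurent series `χᵏ f`. -/
def shift (k : ℤ) (f : ℂ⟦X⟧) : ℂ⸨X⸩ := HahnSeries.single k 1 * (f : ℂ⸨X⸩)

lemma coeff_shift (k : ℤ) (f : ℂ⟦X⟧) (n : ℕ) :
    (shift k f).coeff (k + n) = PowerSeries.coeff n f := by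
  rw [shift, add_comm, HahnSeries.coeff_single_mul_add, one_mul,
    LaurentSeries.coeff_coe_powerSeries]

lemma coeff_shift_of_lt (k : ℤ) (f : ℂ⟦X⟧) {n : ℤ} (hn : n < k) : (shift k f).coeff n = 0 := by
  rw [shift, ← sub_add_cancel n k, HahnSeries.coeff_single_mul_add, one_mul,
    HahnSeries.ofPowerSeries_apply, HahnSeries.embDomain_of_notMem_range]
  simp only [Nat.castOrderEmbedding_apply, Set.mem_range, not_exists]
  intro m
  lia

lemma shift_mul_shift (k l : ℤ) (f g : ℂ⟦X⟧) : shift k f * shift l g = shift (k + l) (f * g) := by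
  have : (HahnSeries.single (k + l) 1 : ℂ⸨X⸩) = HahnSeries.single k 1 * HahnSeries.single l 1 := by
    rw [HahnSeries.single_mul_single, mul_one]
  rw [shift, shift, shift, this, map_mul]
  ring

lemma shift_add (k : ℤ) (f g : ℂ⟦X⟧) : shift k f + shift k g = shift k (f + g) := by
  rw [shift, shift, shift, map_add]; ring

lemma shift_sub (k : ℤ) (f g : ℂ⟦X⟧) : shift k f - shift k g = shift k (f - g) := by
  rw [shift, shift, shift, map_sub]; ring

lemma shift_zero_eq (f : ℂ⟦X⟧) : (f : ℂ⸨X⸩) = shift 0 f := by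
  rw [shift, HahnSeries.single_zero_one, one_mul]

lemma shift_X_pow_mul (k : ℤ) (n : ℕ) (f : ℂ⟦X⟧) :
    shift k (PowerSeries.X ^ n * f) = shift (k + n) f := by
  have : (HahnSeries.single (k + n) 1 : ℂ⸨X⸩) =
      HahnSeries.single k 1 * HahnSeries.single (n : ℤ) 1 := by
    rw [HahnSeries.single_mul_single, mul_one]
  rw [shift, shift, this, map_mul, HahnSeries.ofPowerSeries_X_pow]
  ring

lemma shift_eq_zero {k : ℤ} {f : ℂ⟦X⟧} : shift k f = 0 ↔ f = 0 := by
  constructor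
  · intro h
    ext n
    rw [← coeff_shift k, h]; simp
  · rintro rfl
    simp [shift]

lemma shift_inv (k : ℤ) {f : ℂ⟦X⟧} (hf : PowerSeries.constantCoeff f ≠ 0) :
    (shift k f)⁻¹ = shift (-k) f⁻¹ := by
  refine (eq_inv_of_mul_eq_one_left ?_).symm
  rw [shift_mul_shift, PowerSeries.inv_mul_cancel _ hf, neg_add_cancel, ← shift_zero_eq, map_one]

lemma shift_div (k l : ℤ) (f : ℂ⟦X⟧) {g : ℂ⟦X⟧} (hg : PowerSeries.constantCoeff g ≠ 0) :
    shift k f / shift l g = shift (k - l) (f * g⁻¹) := by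
  rw [div_eq_mul_inv, shift_inv l hg, shift_mul_shift, sub_eq_add_neg]

lemma order_shift (k : ℤ) {f : ℂ⟦X⟧} (hf : PowerSeries.constantCoeff f ≠ 0) :
    (shift k f).order = k := by
  have h0 : (shift k f).coeff k ≠ 0 := by
    have := coeff_shift k f 0
    rw [Nat.cast_zero, add_zero] at this
    rwa [this, PowerSeries.coeff_zero_eq_constantCoeff_apply]
  apply le_antisymm (HahnSeries.order_le_of_coeff_ne_zero h0)
  by_contra hlt
  push Not at hlt
  have hne : shift k f ≠ 0 := fun h => by simp [h] at h0
  exact HahnSeries.coeff_order_eq_zero.not.mpr hne (coeff_shift_of_lt k f hlt)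

lemma exists_eq_shift {h : ℂ⸨X⸩} {k : ℤ} (hh : h ≠ 0) (hk : h.order = k) :
    ∃ f : ℂ⟦X⟧, PowerSeries.constantCoeff f ≠ 0 ∧ h = shift k f := by
  refine ⟨h.powerSeriesPart, ?_, ?_⟩
  · rw [← PowerSeries.coeff_zero_eq_constantCoeff_apply, LaurentSeries.powerSeriesPart_coeff,
      Nat.cast_zero, add_zero]
    exact HahnSeries.coeff_order_eq_zero.not.mpr hh
  · rw [shift, ← hk, LaurentSeries.single_order_mul_powerSeriesPart]

lemma coeff_D (h : ℂ⸨X⸩) (n : ℤ) : (D h).coeff n = (n + 1) * h.coeff (n + 1) := by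
  simp [D]

lemma D_shift (k : ℤ) (f : ℂ⟦X⟧) : D (shift k f) = shift (k - 1) (k * f + euler f) := by
  ext n
  rw [coeff_D]
  have hC : (k : ℂ⟦X⟧) = PowerSeries.C (k : ℂ) := by simp
  rcases lt_or_ge n (k - 1) with hn | hn
  · rw [coeff_shift_of_lt _ _ (by lia), coeff_shift_of_lt _ _ hn, mul_zero]
  · obtain ⟨m, hm⟩ := Int.le.dest hn
    obtain rfl : n = k - 1 + m := hm.symm
    rw [coeff_shift, show k - 1 + (m : ℤ) + 1 = k + m by ring, coeff_shift, map_add, coeff_euler,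
      hC, PowerSeries.coeff_C_mul]
    push_cast
    ring

/-- `χ² w²` times `(log h')''` for `h' = χᵏ w`. -/
def logDerivTerm (k : ℤ) (w : ℂ⟦X⟧) : ℂ⟦X⟧ :=
  w * euler (euler w) - euler w * euler w - w * euler w - k * (w * w)

/-- The logarithmic derivative of `χᵏ w` is `χ⁻¹ (k + θw/w)`; differentiating once more and
multiplying by `χ² w²` clears every denominator. -/
lemma D_log_shift (k : ℤ) {w : ℂ⟦X⟧} (hw : PowerSeries.constantCoeff w ≠ 0) :
    D (D (shift k w) / shift k w) * shift 2 (w * w) = shift 0 (logDerivTerm k w) := by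
  rw [D_shift, shift_div _ _ _ hw, D_shift, shift_mul_shift]
  have hy : w * w⁻¹ = 1 := PowerSeries.mul_inv_cancel _ hw
  have hy' : w * euler w⁻¹ + w⁻¹ * euler w = 0 := by
    rw [← euler_mul, hy]; simp
  have hk : euler (k : ℂ⟦X⟧) = 0 := by simp
  rw [show k - 1 - k - 1 + 2 = (0 : ℤ) by ring]
  congr 1
  rw [euler_mul, map_add, euler_mul, hk, show k - 1 - k = (-1 : ℤ) by ring, logDerivTerm]
  push_cast
  linear_combination (w * (- (k * w + euler w) + (k * euler w + euler (euler w)))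
      - (k * w + euler w) * euler w) * hy
    + (k * w + euler w) * w * hy'

/-! ### The reduced Gauss equation for Laurent series -/

/-- `h` is a nonconstant Laurent solution of the equation with power series coefficients. -/
def SolvesReduced (C : ℂ) (f₁ f₂ f₃ f₄ : ℂ⟦X⟧) (h : ℂ⸨X⸩) : Prop :=
  D h ≠ 0 ∧
  D (D (D h) / D h) + (f₁ : ℂ⸨X⸩) * D h + (f₂ : ℂ⸨X⸩) * (D (D h) / D h)
    + (f₃ : ℂ⸨X⸩) * ((h ^ 2 - HahnSeries.C C) / D h) + (f₄ : ℂ⸨X⸩) = 0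

lemma shift_X_mul (k : ℤ) (f : ℂ⟦X⟧) : shift k (PowerSeries.X * f) = shift (k + 1) f := by
  simpa using shift_X_pow_mul k 1 f

/-- Multiplication by `χ² w²` removes the divisions and exhibits the power of `χ` in front of each
term. For `k = l = -2` the logarithmic term balances the `f₁` term, for `k = 2`, `l = 0` it balances
the `f₃` term; these are the two leading behaviours in the test. -/
lemma solvesReduced_iff (C : ℂ) (f₁ f₂ f₃ f₄ : ℂ⟦X⟧) {h : ℂ⸨X⸩} {k l : ℤ} {w g : ℂ⟦X⟧}
    (hw : PowerSeries.constantCoeff w ≠ 0) (hD : D h = shift k w)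
    (hg : h ^ 2 - HahnSeries.C C = shift l g) :
    SolvesReduced C f₁ f₂ f₃ f₄ h ↔
      shift 0 (logDerivTerm k w) + shift (k + 2) (f₁ * (w * (w * w)))
        + shift 1 (f₂ * ((k * w + euler w) * w)) + shift (l + 2 - k) (f₃ * (g * w))
        + shift 2 (f₄ * (w * w)) = 0 := by
  have hw0 : w ≠ 0 := fun h => by simp [h] at hw
  have hy : w * w⁻¹ = 1 := PowerSeries.mul_inv_cancel _ hw
  have hs : shift 2 (w * w) ≠ 0 := by
    rw [Ne, shift_eq_zero]; exact mul_ne_zero hw0 hw0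
  rw [SolvesReduced, hD, hg, and_iff_right (by rwa [Ne, shift_eq_zero]),
    ← mul_left_inj' hs, zero_mul, add_mul, add_mul, add_mul, add_mul, D_log_shift k hw]
  rw [D_shift, shift_div _ _ _ hw, shift_div _ _ _ hw, shift_zero_eq f₁, shift_zero_eq f₂,
    shift_zero_eq f₃, shift_zero_eq f₄]
  simp only [shift_mul_shift]
  rw [show 0 + k + 2 = k + 2 by ring, show 0 + (k - 1 - k) + 2 = (1 : ℤ) by ring,
    show 0 + (l - k) + 2 = l + 2 - k by ring, show (0 + 2 : ℤ) = 2 by ring,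
    show f₁ * w * (w * w) = f₁ * (w * (w * w)) by ring,
    show f₂ * ((k * w + euler w) * w⁻¹) * (w * w) = f₂ * ((k * w + euler w) * w) by
      linear_combination f₂ * (k * w + euler w) * w * hy,
    show f₃ * (g * w⁻¹) * (w * w) = f₃ * (g * w) by linear_combination f₃ * g * w * hy]

/-- The equation for `h = χ⁻¹ u`, multiplied by `(χ² h')² χ²`, where `w = χ² h'`. -/
def poleOp (C : ℂ) (f₁ f₂ f₃ f₄ u w : ℂ⟦X⟧) : ℂ⟦X⟧ :=
  logDerivTerm (-2) w + f₁ * (w * (w * w))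
    + PowerSeries.X * (f₂ * (w * euler w - 2 * (w * w)))
    + PowerSeries.X * (PowerSeries.X *
        (f₃ * ((u * u - PowerSeries.X ^ 2 * PowerSeries.C C) * w)))
    + PowerSeries.X * (PowerSeries.X * (f₄ * (w * w)))

/-- The equation for `h = e + χ³ s`, multiplied by `(χ⁻² h')² χ²`, where `v = χ⁻² h'`. -/
def zeroOp (C : ℂ) (f₁ f₂ f₃ f₄ e s v : ℂ⟦X⟧) : ℂ⟦X⟧ :=
  logDerivTerm 2 v + PowerSeries.X ^ 4 * (f₁ * (v * (v * v)))
    + PowerSeries.X * (f₂ * (v * euler v + 2 * (v * v)))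
    + f₃ * (((e + PowerSeries.X ^ 3 * s) * (e + PowerSeries.X ^ 3 * s) - PowerSeries.C C) * v)
    + PowerSeries.X * (PowerSeries.X * (f₄ * (v * v)))

lemma solvesReduced_pole_iff (C : ℂ) (f₁ f₂ f₃ f₄ : ℂ⟦X⟧) {u : ℂ⟦X⟧}
    (hu : PowerSeries.constantCoeff u ≠ 0) :
    SolvesReduced C f₁ f₂ f₃ f₄ (shift (-1) u) ↔ poleOp C f₁ f₂ f₃ f₄ u (euler u - u) = 0 := by
  have hD : D (shift (-1) u) = shift (-2) (euler u - u) := by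
    rw [D_shift]; congr 1; push_cast; ring
  have hg : shift (-1) u ^ 2 - HahnSeries.C C =
      shift (-2) (u * u - PowerSeries.X ^ 2 * PowerSeries.C C) := by
    rw [← shift_sub, shift_X_pow_mul, pow_two, shift_mul_shift]
    congr 1
    rw [show (-2 : ℤ) + (2 : ℕ) = 0 by norm_num, ← shift_zero_eq, HahnSeries.ofPowerSeries_C]
  rw [solvesReduced_iff C f₁ f₂ f₃ f₄ (by simpa [constantCoeff_euler] using hu) hD hg,
    poleOp, ← shift_eq_zero (k := 0), ← shift_add, ← shift_add, ← shift_add, ← shift_add]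
  simp only [shift_X_mul]
  generalize euler u - u = w
  norm_num
  rw [show (-(2 * w) + euler w) * w = w * euler w - 2 * (w * w) by ring]

lemma D_const_add_shift (e : ℂ) (s : ℂ⟦X⟧) :
    D (shift 0 (PowerSeries.C e + PowerSeries.X ^ 3 * s)) = shift 2 (3 * s + euler s) := by
  have hC : euler (PowerSeries.C e) = 0 := euler.map_algebraMap e
  rw [D_shift, map_add, hC, euler_X_pow_mul, zero_add, Int.cast_zero, zero_mul, zero_add,
    shift_X_pow_mul]
  norm_num

lemma solvesReduced_zero_iff (C : ℂ) (f₁ f₂ f₃ f₄ : ℂ⟦X⟧) (e : ℂ) {s : ℂ⟦X⟧}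
    (hs : PowerSeries.constantCoeff s ≠ 0) :
    SolvesReduced C f₁ f₂ f₃ f₄ (shift 0 (PowerSeries.C e + PowerSeries.X ^ 3 * s)) ↔
      zeroOp C f₁ f₂ f₃ f₄ (PowerSeries.C e) s (3 * s + euler s) = 0 := by
  have hg : shift 0 (PowerSeries.C e + PowerSeries.X ^ 3 * s) ^ 2 - HahnSeries.C C =
      shift 0 ((PowerSeries.C e + PowerSeries.X ^ 3 * s) * (PowerSeries.C e + PowerSeries.X ^ 3 * s)
        - PowerSeries.C C) := by
    rw [← shift_sub, pow_two, shift_mul_shift, add_zero, ← shift_zero_eq (PowerSeries.C C),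
      HahnSeries.ofPowerSeries_C]
  have hv : PowerSeries.constantCoeff (3 * s + euler s) ≠ 0 := by
    rw [map_add, constantCoeff_euler, map_mul, map_ofNat]
    simpa using hs
  rw [solvesReduced_iff C f₁ f₂ f₃ f₄ hv (D_const_add_shift e s) hg,
    zeroOp, ← shift_eq_zero (k := 0), ← shift_add, ← shift_add, ← shift_add, ← shift_add]
  rw [shift_X_pow_mul, shift_X_mul, shift_X_mul, shift_X_mul]
  generalize 3 * s + euler s = v
  norm_num
  rw [show (2 * v + euler v) * v = v * euler v + 2 * (v * v) by ring]

/-! ### The compatibility conditions -/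

lemma constantCoeff_two : PowerSeries.constantCoeff (2 : ℂ⟦X⟧) = 2 :=
  map_ofNat PowerSeries.constantCoeff 2

lemma coeff_succ_two (n : ℕ) : PowerSeries.coeff (n + 1) (2 : ℂ⟦X⟧) = 0 := by
  rw [← map_ofNat (PowerSeries.C (R := ℂ)) 2, PowerSeries.coeff_C, if_neg n.succ_ne_zero]

lemma coeff_one_mul_eq (a b : ℂ⟦X⟧) : PowerSeries.coeff 1 (a * b) =
    PowerSeries.constantCoeff a * PowerSeries.coeff 1 b
      + PowerSeries.coeff 1 a * PowerSeries.constantCoeff b := by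
  simp [PowerSeries.coeff_mul, Finset.Nat.antidiagonal_succ]

lemma coeff_two_mul_eq (a b : ℂ⟦X⟧) : PowerSeries.coeff 2 (a * b) =
    PowerSeries.constantCoeff a * PowerSeries.coeff 2 b
      + PowerSeries.coeff 1 a * PowerSeries.coeff 1 b
      + PowerSeries.coeff 2 a * PowerSeries.constantCoeff b := by
  simp [PowerSeries.coeff_mul, Finset.Nat.antidiagonal_succ]
  ring

lemma constantCoeff_poleOp (C : ℂ) (f₁ f₂ f₃ f₄ u w : ℂ⟦X⟧) :
    PowerSeries.constantCoeff (poleOp C f₁ f₂ f₃ f₄ u w) = PowerSeries.constantCoeff w ^ 2 *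
      (2 + PowerSeries.constantCoeff f₁ * PowerSeries.constantCoeff w) := by
  simp [poleOp, logDerivTerm, constantCoeff_euler, constantCoeff_two]
  ring

/-- The hypothesis on `w` holds for `w = θu - u`, whose `n`-th coefficient is `(n - 1) uₙ`. This is
why `u₁` drops out and order 1 becomes a condition on the equation. -/
lemma coeff_one_poleOp (C : ℂ) (f₁ f₂ f₃ f₄ u w : ℂ⟦X⟧) (hw : PowerSeries.coeff 1 w = 0) :
    PowerSeries.coeff 1 (poleOp C f₁ f₂ f₃ f₄ u w) = PowerSeries.constantCoeff w ^ 2 *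
      (PowerSeries.coeff 1 f₁ * PowerSeries.constantCoeff w
        - 2 * PowerSeries.constantCoeff f₂) := by
  simp [poleOp, logDerivTerm, constantCoeff_euler, coeff_one_mul_eq, hw, coeff_euler, constantCoeff_two,
    coeff_succ_two 0]
  ring

/-- The factor of the second coefficient of `w` is the one that vanishes at order 0, so order 2 is
the second resonance. -/
lemma coeff_two_poleOp (C : ℂ) (f₁ f₂ f₃ f₄ u w : ℂ⟦X⟧) (hw : PowerSeries.coeff 1 w = 0) :
    PowerSeries.coeff 2 (poleOp C f₁ f₂ f₃ f₄ u w) =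
      3 * PowerSeries.constantCoeff w * PowerSeries.coeff 2 w *
        (2 + PowerSeries.constantCoeff f₁ * PowerSeries.constantCoeff w)
      + PowerSeries.constantCoeff w * (PowerSeries.coeff 2 f₁ * PowerSeries.constantCoeff w ^ 2
        - 2 * PowerSeries.coeff 1 f₂ * PowerSeries.constantCoeff w
        + PowerSeries.constantCoeff f₃ * PowerSeries.constantCoeff u ^ 2
        + PowerSeries.constantCoeff f₄ * PowerSeries.constantCoeff w) := by
  simp [poleOp, logDerivTerm, constantCoeff_euler, coeff_one_mul_eq, coeff_two_mul_eq,
    hw, coeff_euler, constantCoeff_two,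
    coeff_succ_two 0, coeff_succ_two 1]
  ring

lemma constantCoeff_zeroOp (C : ℂ) (f₁ f₂ f₃ f₄ s v : ℂ⟦X⟧) (e : ℂ) :
    PowerSeries.constantCoeff (zeroOp C f₁ f₂ f₃ f₄ (PowerSeries.C e) s v) =
      PowerSeries.constantCoeff v * (PowerSeries.constantCoeff f₃ * (e ^ 2 - C)
        - 2 * PowerSeries.constantCoeff v) := by
  simp [zeroOp, logDerivTerm, constantCoeff_euler, constantCoeff_two]
  ring

lemma coeff_one_zeroOp (C : ℂ) (f₁ f₂ f₃ f₄ s v : ℂ⟦X⟧) (e : ℂ) :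
    PowerSeries.coeff 1 (zeroOp C f₁ f₂ f₃ f₄ (PowerSeries.C e) s v) =
      PowerSeries.constantCoeff v * (2 * PowerSeries.constantCoeff f₂ * PowerSeries.constantCoeff v
        + PowerSeries.coeff 1 f₃ * (e ^ 2 - C)) + PowerSeries.coeff 1 v *
        (PowerSeries.constantCoeff f₃ * (e ^ 2 - C) - 4 * PowerSeries.constantCoeff v) := by
  simp [zeroOp, logDerivTerm, constantCoeff_euler, coeff_one_mul_eq, coeff_euler, constantCoeff_two,
    coeff_succ_two 0, pow_succ]
  ring

lemma coeff_two_zeroOp (C : ℂ) (f₁ f₂ f₃ f₄ s v : ℂ⟦X⟧) (e : ℂ) :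
    PowerSeries.coeff 2 (zeroOp C f₁ f₂ f₃ f₄ (PowerSeries.C e) s v) =
      PowerSeries.coeff 2 v *
        (PowerSeries.constantCoeff f₃ * (e ^ 2 - C) - 2 * PowerSeries.constantCoeff v)
      - 3 * PowerSeries.coeff 1 v ^ 2
      + 5 * PowerSeries.constantCoeff f₂ * PowerSeries.constantCoeff v * PowerSeries.coeff 1 v
      + 2 * PowerSeries.coeff 1 f₂ * PowerSeries.constantCoeff v ^ 2
      + (e ^ 2 - C) * (PowerSeries.coeff 1 f₃ * PowerSeries.coeff 1 v
        + PowerSeries.coeff 2 f₃ * PowerSeries.constantCoeff v)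
      + PowerSeries.constantCoeff f₄ * PowerSeries.constantCoeff v ^ 2 := by
  simp [zeroOp, logDerivTerm, constantCoeff_euler, coeff_one_mul_eq, coeff_two_mul_eq,
    coeff_euler, constantCoeff_two, coeff_succ_two 0, coeff_succ_two 1, pow_succ]
  ring

/-- Compatibility conditions at a simple pole of `h`. -/
def PoleCompatible (f₁ f₂ f₃ f₄ : ℂ⟦X⟧) : Prop :=
  PowerSeries.coeff 1 f₁ = -(PowerSeries.constantCoeff f₁ * PowerSeries.constantCoeff f₂) ∧
  PowerSeries.constantCoeff f₁ * PowerSeries.constantCoeff f₄ =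
    2 * (PowerSeries.coeff 2 f₁ + PowerSeries.constantCoeff f₁ * PowerSeries.coeff 1 f₂
      + PowerSeries.constantCoeff f₃)

/-- Compatibility condition at a double zero of `h'`. -/
def ZeroCompatible (f₂ f₃ f₄ : ℂ⟦X⟧) : Prop :=
  2 * PowerSeries.constantCoeff f₂ ^ 2 * PowerSeries.constantCoeff f₃ ^ 2
    + PowerSeries.constantCoeff f₂ * PowerSeries.coeff 1 f₃ * PowerSeries.constantCoeff f₃
    - PowerSeries.coeff 1 f₃ ^ 2
    + 2 * PowerSeries.coeff 1 f₂ * PowerSeries.constantCoeff f₃ ^ 2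
    + 2 * PowerSeries.coeff 2 f₃ * PowerSeries.constantCoeff f₃
    + PowerSeries.constantCoeff f₄ * PowerSeries.constantCoeff f₃ ^ 2 = 0

lemma SolvesReduced.poleCompatible {C : ℂ} {f₁ f₂ f₃ f₄ : ℂ⟦X⟧} {h : ℂ⸨X⸩}
    (hs : SolvesReduced C f₁ f₂ f₃ f₄ h) (ho : h.order = -1) : PoleCompatible f₁ f₂ f₃ f₄ := by
  have hh : h ≠ 0 := fun h0 => by simp [h0] at ho
  obtain ⟨u, hu, rfl⟩ := exists_eq_shift hh ho
  rw [solvesReduced_pole_iff C f₁ f₂ f₃ f₄ hu] at hs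
  set w := euler u - u with hw
  have hw0 : PowerSeries.constantCoeff w = -PowerSeries.constantCoeff u := by
    simp [hw, constantCoeff_euler]
  have hw1 : PowerSeries.coeff 1 w = 0 := by simp [hw, coeff_euler]
  have e0 := constantCoeff_poleOp C f₁ f₂ f₃ f₄ u w
  have e1 := coeff_one_poleOp C f₁ f₂ f₃ f₄ u w hw1
  have e2 := coeff_two_poleOp C f₁ f₂ f₃ f₄ u w hw1
  rw [hs, map_zero] at e0 e1 e2
  have hw0' : PowerSeries.constantCoeff w ≠ 0 := by rw [hw0]; exact neg_ne_zero.mpr hu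
  have hu' : PowerSeries.constantCoeff u = - PowerSeries.constantCoeff w := by rw [hw0, neg_neg]
  rw [hu'] at e2
  generalize PowerSeries.constantCoeff w = w0 at *
  -- Order 0 gives `w₀ = -2/f₁(0)`, that is `u₀ = 2/f₁(0)`.
  have r0 := (mul_eq_zero.mp e0.symm).resolve_left (pow_ne_zero 2 hw0')
  have r1 := (mul_eq_zero.mp e1.symm).resolve_left (pow_ne_zero 2 hw0')
  rw [r0, mul_zero, zero_add] at e2
  have r2 : PowerSeries.coeff 2 f₁ * w0 - 2 * PowerSeries.coeff 1 f₂
      + PowerSeries.constantCoeff f₃ * w0 + PowerSeries.constantCoeff f₄ = 0 := by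
    apply (mul_eq_zero.mp (_ : w0 ^ 2 * _ = 0)).resolve_left (pow_ne_zero 2 hw0')
    linear_combination -e2
  refine ⟨mul_left_cancel₀ hw0' ?_, mul_left_cancel₀ hw0' ?_⟩
  · linear_combination r1 + PowerSeries.constantCoeff f₂ * r0
  · linear_combination w0 * PowerSeries.constantCoeff f₁ * r2
      - (w0 * PowerSeries.coeff 2 f₁ + w0 * PowerSeries.constantCoeff f₃) * r0

/-- Every `θw` has zero constant coefficient, so `(θw)²` does not contribute; the other terms give
`n²`, `-n` and `-2k`. -/
lemma agreesTo_logDerivTerm {n : ℕ} (hn : n ≠ 0) (k : ℤ) {w w' : ℂ⟦X⟧} {δ : ℂ}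
    (h : AgreesTo n w w' δ) : AgreesTo n (logDerivTerm k w) (logDerivTerm k w')
      (PowerSeries.constantCoeff w * δ * (n ^ 2 - n - 2 * k)) := by
  refine ((((h.mul hn h.euler.euler).sub (h.euler.mul hn h.euler)).sub (h.mul hn h.euler)).sub
    ((h.mul hn h).const_mul _)).congr ?_
  have hk : PowerSeries.constantCoeff (k : ℂ⟦X⟧) = k := map_intCast _ k
  rw [constantCoeff_euler, constantCoeff_euler, hk]
  ring

lemma AgreesTo.X_mul {n : ℕ} {a b : ℂ⟦X⟧} {δ : ℂ} (h : AgreesTo n a b δ) :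
    AgreesTo n (PowerSeries.X * a) (PowerSeries.X * b) 0 :=
  (h.const_mul _).congr (by simp)

lemma agreesTo_add_X_pow_mul (n : ℕ) (u d : ℂ⟦X⟧) :
    AgreesTo n u (u + PowerSeries.X ^ n * d) (PowerSeries.constantCoeff d) := ⟨d, rfl, rfl⟩

lemma exists_pole_solution (C : ℂ) {f₁ f₂ f₃ f₄ : ℂ⟦X⟧} (hf : PowerSeries.constantCoeff f₁ ≠ 0)
    (hc : PoleCompatible f₁ f₂ f₃ f₄) (u₁ u₂ : ℂ) :
    ∃ h : ℂ⸨X⸩, SolvesReduced C f₁ f₂ f₃ f₄ h ∧ h.order = -1 ∧ h.coeff 0 = u₁ ∧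
      h.coeff 1 = u₂ := by
  set u₀ : ℂ := 2 / PowerSeries.constantCoeff f₁ with hu₀
  have hu₀0 : u₀ ≠ 0 := div_ne_zero two_ne_zero hf
  have hfu : PowerSeries.constantCoeff f₁ * u₀ = 2 := by rw [hu₀]; field_simp
  -- Only the first three coefficients matter: the recursion starts at order 3, beyond the
  -- resonances 1 and 2.
  let v : ℂ⟦X⟧ := PowerSeries.mk fun n => if n = 0 then u₀ else if n = 1 then u₁ else
    if n = 2 then u₂ else 0
  have hv0 : PowerSeries.constantCoeff v = u₀ := by
    rw [← PowerSeries.coeff_zero_eq_constantCoeff_apply, PowerSeries.coeff_mk]; simp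
  suffices ∃ u : ℂ⟦X⟧, (∀ m < 3, PowerSeries.coeff m u = PowerSeries.coeff m v) ∧
      poleOp C f₁ f₂ f₃ f₄ u (euler u - u) = 0 by
    obtain ⟨u, hu, hsol⟩ := this
    have hu0 : PowerSeries.constantCoeff u = u₀ := by
      rw [← hv0]; simpa using hu 0 (by norm_num)
    have hu0' : PowerSeries.constantCoeff u ≠ 0 := by rwa [hu0]
    refine ⟨shift (-1) u, (solvesReduced_pole_iff C f₁ f₂ f₃ f₄ hu0').mpr hsol,
      order_shift _ hu0', ?_, ?_⟩
    · have := coeff_shift (-1) u 1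
      rw [hu 1 (by norm_num), PowerSeries.coeff_mk] at this
      simpa using this
    · have := coeff_shift (-1) u 2
      rw [hu 2 (by norm_num), PowerSeries.coeff_mk] at this
      norm_num at this
      exact this
  -- A variation `δ χⁿ` of `u` changes `w` by `(n - 1) δ χⁿ`. With `w₀ = -u₀` the logarithmic term
  -- contributes `-u₀ (n² - n + 4)` and the `f₁` term `3 f₁(0) u₀² = 6 u₀`, each times `(n - 1) δ`.
  refine exists_formal_solution (fun u => poleOp C f₁ f₂ f₃ f₄ u (euler u - u)) 3 v
    (fun n => -u₀ * ((n - 1) * ((n - 2) * (n + 1)))) ?_ ?_ ?_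
  · intro n hn
    have h1 : (n : ℂ) - 1 ≠ 0 := by rw [sub_ne_zero]; norm_cast; lia
    have h2 : (n : ℂ) - 2 ≠ 0 := by rw [sub_ne_zero]; norm_cast; lia
    have h3 : (n : ℂ) + 1 ≠ 0 := by norm_cast
    exact mul_ne_zero (neg_ne_zero.mpr hu₀0) (mul_ne_zero h1 (mul_ne_zero h2 h3))
  · obtain ⟨h1, h2⟩ := hc
    have hw1 : PowerSeries.coeff 1 (euler v - v) = 0 := by simp [coeff_euler]
    have hw0 : PowerSeries.constantCoeff (euler v - v) = -u₀ := by
      simp [constantCoeff_euler, hv0]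
    intro m hm
    interval_cases m
    · rw [PowerSeries.coeff_zero_eq_constantCoeff_apply, constantCoeff_poleOp, hw0]
      linear_combination -u₀ ^ 2 * hfu
    · rw [coeff_one_poleOp _ _ _ _ _ _ _ hw1, hw0, h1]
      linear_combination u₀ ^ 2 * PowerSeries.constantCoeff f₂ * hfu
    · rw [coeff_two_poleOp _ _ _ _ _ _ _ hw1, hw0, hv0]
      have : PowerSeries.constantCoeff f₄ = u₀ * (PowerSeries.coeff 2 f₁
          + PowerSeries.constantCoeff f₁ * PowerSeries.coeff 1 f₂
          + PowerSeries.constantCoeff f₃) := by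
        apply mul_left_cancel₀ hf
        linear_combination h2 - (PowerSeries.coeff 2 f₁
          + PowerSeries.constantCoeff f₁ * PowerSeries.coeff 1 f₂
          + PowerSeries.constantCoeff f₃) * hfu
      rw [this]
      linear_combination (3 * u₀ * PowerSeries.coeff 2 (euler v - v)
        + u₀ ^ 2 * PowerSeries.coeff 1 f₂) * hfu
  · intro n hn u d hu
    have hu0 : PowerSeries.constantCoeff u = u₀ := by
      rw [← hv0]; simpa using hu 0 (by norm_num)
    have hn0 : n ≠ 0 := by lia
    have hA := agreesTo_add_X_pow_mul n u d
    have hw := hA.euler.sub hA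
    refine (((((agreesTo_logDerivTerm hn0 (-2) hw).add
      ((hw.mul hn0 (hw.mul hn0 hw)).const_mul _)).add
      (((hw.mul hn0 hw.euler).sub ((hw.mul hn0 hw).const_mul _)).const_mul _).X_mul).add
      ((((hA.mul hn0 hA).sub (AgreesTo.refl n _)).mul hn0 hw).const_mul _).X_mul.X_mul).add
      ((hw.mul hn0 hw).const_mul _).X_mul.X_mul).congr ?_
    simp only [map_sub, map_mul, constantCoeff_euler, hu0]
    push_cast
    linear_combination 3 * u₀ * (n - 1) * PowerSeries.constantCoeff d * hfu

/-- The power series `s` with `3 s + θ s = v`. -/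
def integralCoeff (v : ℂ⟦X⟧) : ℂ⟦X⟧ := PowerSeries.mk fun n => PowerSeries.coeff n v / (n + 3)

lemma coeff_three_mul_add_euler (s : ℂ⟦X⟧) (n : ℕ) :
    PowerSeries.coeff n (3 * s + euler s) = (n + 3) * PowerSeries.coeff n s := by
  rw [map_add, coeff_euler, ← map_ofNat (PowerSeries.C (R := ℂ)) 3, PowerSeries.coeff_C_mul]
  ring

lemma three_mul_integralCoeff_add_euler (v : ℂ⟦X⟧) :
    3 * integralCoeff v + euler (integralCoeff v) = v := by
  ext n
  have : (n : ℂ) + 3 ≠ 0 := by norm_cast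
  rw [coeff_three_mul_add_euler, integralCoeff, PowerSeries.coeff_mk]
  field_simp

/-- Formal integration: each coefficient of `h` of index `n ≠ 0` is read off `D h`, and `h.coeff 0`
is the constant of integration. -/
lemma eq_shift_of_D_eq {h : ℂ⸨X⸩} {v : ℂ⟦X⟧} (hD : D h = shift 2 v) :
    h = shift 0 (PowerSeries.C (h.coeff 0) + PowerSeries.X ^ 3 * integralCoeff v) := by
  have hD' := D_const_add_shift (h.coeff 0) (integralCoeff v)
  rw [three_mul_integralCoeff_add_euler, ← hD] at hD'
  ext n
  rcases eq_or_ne n 0 with rfl | hn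
  · have := coeff_shift 0 (PowerSeries.C (h.coeff 0) + PowerSeries.X ^ 3 * integralCoeff v) 0
    rw [Nat.cast_zero, add_zero] at this
    rw [this]
    simp
  · have := congrArg (fun g : ℂ⸨X⸩ => g.coeff (n - 1)) hD'
    simp only [coeff_D, sub_add_cancel] at this
    have hn' : ((n - 1 : ℤ) : ℂ) + 1 ≠ 0 := by push_cast; simpa using hn
    exact (mul_left_cancel₀ hn' this).symm

lemma SolvesReduced.zeroCompatible {C : ℂ} {f₁ f₂ f₃ f₄ : ℂ⟦X⟧} {h : ℂ⸨X⸩}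
    (hs : SolvesReduced C f₁ f₂ f₃ f₄ h) (ho : ((D h)⁻¹).order = -2) :
    ZeroCompatible f₂ f₃ f₄ := by
  obtain ⟨q, hq, hDq⟩ := exists_eq_shift (inv_ne_zero hs.1) ho
  obtain ⟨v, hv, hD⟩ : ∃ v : ℂ⟦X⟧, PowerSeries.constantCoeff v ≠ 0 ∧ D h = shift 2 v :=
    ⟨q⁻¹, by simpa using hq, by rw [← inv_inv (D h), hDq, shift_inv _ hq, neg_neg]⟩
  have hh := eq_shift_of_D_eq hD
  generalize h.coeff 0 = e at hh
  subst hh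
  have hs0 : PowerSeries.constantCoeff (integralCoeff v) ≠ 0 := by
    rw [← PowerSeries.coeff_zero_eq_constantCoeff_apply] at hv ⊢
    simpa [integralCoeff] using hv
  rw [solvesReduced_zero_iff C f₁ f₂ f₃ f₄ e hs0, three_mul_integralCoeff_add_euler] at hs
  have e0 := constantCoeff_zeroOp C f₁ f₂ f₃ f₄ (integralCoeff v) v e
  have e1 := coeff_one_zeroOp C f₁ f₂ f₃ f₄ (integralCoeff v) v e
  have e2 := coeff_two_zeroOp C f₁ f₂ f₃ f₄ (integralCoeff v) v e
  rw [hs, map_zero] at e0 e1 e2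
  have r0 := (mul_eq_zero.mp e0.symm).resolve_left hv
  rw [r0, mul_zero] at e2
  unfold ZeroCompatible
  generalize PowerSeries.constantCoeff v = v0 at *
  generalize PowerSeries.coeff 1 v = v1 at *
  generalize e ^ 2 - C = K at *
  generalize PowerSeries.constantCoeff f₃ = p at *
  generalize PowerSeries.coeff 1 f₃ = p1 at *
  generalize PowerSeries.coeff 2 f₃ = p2 at *
  generalize PowerSeries.constantCoeff f₂ = a at *
  -- Everything is kept multiplied by powers of `p = f₃(0)`, so no division by `p` is needed.
  have r1 : v1 * p = v0 * (a * p + p1) := by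
    apply mul_left_cancel₀ (mul_ne_zero two_ne_zero hv)
    linear_combination p * e1 + (v1 * p + v0 * p1) * r0
  apply mul_left_cancel₀ (pow_ne_zero 2 hv)
  linear_combination -p ^ 2 * e2 - (p * p1 * v1 + p * p2 * v0) * r0
    + (3 * (v1 * p + v0 * (a * p + p1)) - 5 * a * v0 * p - 2 * p1 * v0) * r1

lemma coeff_two_inv {v : ℂ⟦X⟧} (hv : PowerSeries.constantCoeff v ≠ 0) :
    PowerSeries.coeff 2 v⁻¹ * PowerSeries.constantCoeff v ^ 3 =
      PowerSeries.coeff 1 v ^ 2 - PowerSeries.coeff 2 v * PowerSeries.constantCoeff v := by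
  have h := PowerSeries.mul_inv_cancel _ hv
  have h1 := congrArg (PowerSeries.coeff 1) h
  have h2 := congrArg (PowerSeries.coeff 2) h
  rw [coeff_one_mul_eq, PowerSeries.coeff_one, if_neg one_ne_zero] at h1
  rw [coeff_two_mul_eq, PowerSeries.coeff_one, if_neg two_ne_zero] at h2
  have h0 : PowerSeries.constantCoeff v * PowerSeries.constantCoeff v⁻¹ = 1 := by
    rw [← map_mul, h, map_one]
  generalize PowerSeries.constantCoeff v = v0 at *
  linear_combination v0 ^ 2 * h2 - v0 * PowerSeries.coeff 1 v * h1
    + (PowerSeries.coeff 1 v ^ 2 - v0 * PowerSeries.coeff 2 v) * h0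

lemma exists_zero_solution (C : ℂ) {f₁ f₂ f₃ f₄ : ℂ⟦X⟧} (hf : PowerSeries.constantCoeff f₃ ≠ 0)
    (hc : ZeroCompatible f₂ f₃ f₄) {g₀ : ℂ} (hg₀ : g₀ ≠ 0) (g₂ : ℂ) :
    ∃ h : ℂ⸨X⸩, SolvesReduced C f₁ f₂ f₃ f₄ h ∧ ((D h)⁻¹).order = -2 ∧
      ((D h)⁻¹).coeff (-2) = g₀ ∧ ((D h)⁻¹).coeff 0 = g₂ := by
  set p := PowerSeries.constantCoeff f₃ with hp
  set p₁ := PowerSeries.coeff 1 f₃ with hp₁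
  set a := PowerSeries.constantCoeff f₂ with ha
  -- The order 0 equation `f₃(0)(e² - C) = 2 v₀` with `v₀ = 1/g₀` prescribes `e²`; the root may be
  -- complex.
  obtain ⟨e, he⟩ := IsAlgClosed.exists_pow_nat_eq (C + 2 / (p * g₀)) (n := 2) two_pos
  have hv₀0 : g₀⁻¹ ≠ 0 := inv_ne_zero hg₀
  have heC : p * (e ^ 2 - C) = 2 * g₀⁻¹ := by rw [he]; field_simp; ring
  set v₀ := g₀⁻¹ with hv₀
  -- `v₁` solves the order 1 equation; `v₂` is free there and is chosen so that `1/v` has second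
  -- coefficient `g₂`, as in `coeff_two_inv`.
  set v₁ : ℂ := v₀ * (a * p + p₁) / p with hv₁
  set v₂ : ℂ := (v₁ ^ 2 - g₂ * v₀ ^ 3) / v₀ with hv₂
  have hpv₁ : p * v₁ = v₀ * (a * p + p₁) := by rw [hv₁]; field_simp
  let v : ℂ⟦X⟧ := PowerSeries.mk fun n => if n = 0 then v₀ else if n = 1 then v₁ else
    if n = 2 then v₂ else 0
  have hcv0 : PowerSeries.constantCoeff v = v₀ := by
    rw [← PowerSeries.coeff_zero_eq_constantCoeff_apply, PowerSeries.coeff_mk]; simp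
  have hcv1 : PowerSeries.coeff 1 v = v₁ := by rw [PowerSeries.coeff_mk]; simp
  have hcv2 : PowerSeries.coeff 2 v = v₂ := by rw [PowerSeries.coeff_mk]; simp
  suffices ∃ s : ℂ⟦X⟧, (∀ m < 3, PowerSeries.coeff m s = PowerSeries.coeff m (integralCoeff v)) ∧
      zeroOp C f₁ f₂ f₃ f₄ (PowerSeries.C e) s (3 * s + euler s) = 0 by
    obtain ⟨s, hs, hsol⟩ := this
    have hw : ∀ m < 3, PowerSeries.coeff m (3 * s + euler s) = PowerSeries.coeff m v := by
      intro m hm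
      rw [← three_mul_integralCoeff_add_euler v, coeff_three_mul_add_euler,
        coeff_three_mul_add_euler, hs m hm]
    have hs0 : PowerSeries.constantCoeff s ≠ 0 := by
      rw [← PowerSeries.coeff_zero_eq_constantCoeff_apply, hs 0 (by norm_num)]
      simpa [integralCoeff, hcv0] using hv₀0
    have hw0 : PowerSeries.constantCoeff (3 * s + euler s) = v₀ := by
      rw [← hcv0]; simpa using hw 0 (by norm_num)
    have hw0' : PowerSeries.constantCoeff (3 * s + euler s) ≠ 0 := by rwa [hw0]
    refine ⟨_, (solvesReduced_zero_iff C f₁ f₂ f₃ f₄ e hs0).mpr hsol, ?_⟩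
    rw [D_const_add_shift, shift_inv _ hw0']
    refine ⟨order_shift _ (by simpa using hw0'), ?_, ?_⟩
    · have := coeff_shift (-2) (3 * s + euler s)⁻¹ 0
      rw [PowerSeries.coeff_zero_eq_constantCoeff_apply, PowerSeries.constantCoeff_inv, hw0,
        hv₀, inv_inv] at this
      simpa using this
    · have h2 := coeff_two_inv hw0'
      rw [hw0, hw 1 (by norm_num), hw 2 (by norm_num), hcv1, hcv2] at h2
      have := coeff_shift (-2) (3 * s + euler s)⁻¹ 2
      rw [show (-2 : ℤ) + (2 : ℕ) = 0 by norm_num] at this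
      rw [this]
      apply mul_right_cancel₀ (pow_ne_zero 3 hv₀0)
      rw [h2, hv₂]
      field_simp
      ring
  -- A variation `δ χⁿ` of `s` changes `v` by `(n + 3) δ χⁿ`. The logarithmic term contributes `v₀
  -- (n² - n - 4)` and the `f₃` term `2 v₀`; the variation of `χ³ s` itself enters only at higher
  -- order.
  refine exists_formal_solution
    (fun s => zeroOp C f₁ f₂ f₃ f₄ (PowerSeries.C e) s (3 * s + euler s)) 3 (integralCoeff v)
    (fun n => v₀ * ((n + 3) * ((n - 2) * (n + 1)))) ?_ ?_ ?_
  · intro n hn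
    have h1 : (n : ℂ) + 3 ≠ 0 := by norm_cast
    have h2 : (n : ℂ) - 2 ≠ 0 := by rw [sub_ne_zero]; norm_cast; lia
    have h3 : (n : ℂ) + 1 ≠ 0 := by norm_cast
    exact mul_ne_zero hv₀0 (mul_ne_zero h1 (mul_ne_zero h2 h3))
  · intro m hm
    simp only [three_mul_integralCoeff_add_euler]
    interval_cases m
    · rw [PowerSeries.coeff_zero_eq_constantCoeff_apply, constantCoeff_zeroOp, hcv0]
      linear_combination v₀ * heC
    · rw [coeff_one_zeroOp, hcv0, hcv1]
      apply mul_left_cancel₀ hf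
      linear_combination (p * v₁ + v₀ * p₁) * heC - 2 * v₀ * hpv₁
    · rw [coeff_two_zeroOp, hcv0, hcv1, hcv2]
      unfold ZeroCompatible at hc
      apply mul_left_cancel₀ (pow_ne_zero 2 hf)
      linear_combination v₀ ^ 2 * hc
        + (p ^ 2 * v₂ + p * p₁ * v₁ + p * PowerSeries.coeff 2 f₃ * v₀) * heC
        - (3 * (v₁ * p + v₀ * (a * p + p₁)) - 5 * a * v₀ * p - 2 * p₁ * v₀) * hpv₁
  · intro n hn s d hs
    have hs0 : PowerSeries.constantCoeff (3 * s + euler s) = v₀ := by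
      rw [← hcv0, ← three_mul_integralCoeff_add_euler v,
        ← PowerSeries.coeff_zero_eq_constantCoeff_apply,
        ← PowerSeries.coeff_zero_eq_constantCoeff_apply, coeff_three_mul_add_euler,
        coeff_three_mul_add_euler, hs 0 (by norm_num)]
    have hn0 : n ≠ 0 := by lia
    have hA := agreesTo_add_X_pow_mul n s d
    have hv := (hA.const_mul 3).add hA.euler
    have hE := (AgreesTo.refl n (PowerSeries.C e)).add (hA.const_mul (PowerSeries.X ^ 3))
    refine (((((agreesTo_logDerivTerm hn0 2 hv).add
      ((hv.mul hn0 (hv.mul hn0 hv)).const_mul _ |>.const_mul _)).add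
      (((hv.mul hn0 hv.euler).add ((hv.mul hn0 hv).const_mul _)).const_mul _).X_mul).add
      ((((hE.mul hn0 hE).sub (AgreesTo.refl n _)).mul hn0 hv).const_mul _)).add
      ((hv.mul hn0 hv).const_mul _).X_mul.X_mul).congr ?_
    have h3 : PowerSeries.constantCoeff (3 : ℂ⟦X⟧) = 3 := map_ofNat _ 3
    rw [hs0]
    simp only [map_add, map_sub, map_mul, map_pow, PowerSeries.constantCoeff_X, h3,
      PowerSeries.constantCoeff_C]
    push_cast
    linear_combination (n + 3) * PowerSeries.constantCoeff d * heC

/-! ### The equation solved by `sinh² (4 a x) / (4 a)²` -/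

lemma hasDerivAt_cosh_mul (a : ℂ) (x : ℝ) :
    HasDerivAt (fun y : ℝ => Complex.cosh (4 * a * y)) ((4 * a) ^ 2 * sinhScaled a x) x := by
  have h : HasDerivAt (fun y : ℂ => 4 * a * y) (4 * a) x := by
    simpa using (hasDerivAt_id (x : ℂ)).const_mul (4 * a)
  refine h.ccosh.comp_ofReal.congr_deriv ?_
  rcases eq_or_ne a 0 with rfl | ha
  · simp
  · rw [sinhScaled, if_neg ha]; field_simp

lemma hasDerivAt_sinhScaled (a : ℂ) (x : ℝ) :
    HasDerivAt (fun y : ℝ => sinhScaled a y) (Complex.cosh (4 * a * x)) x := by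
  rcases eq_or_ne a 0 with rfl | ha
  · simpa [sinhScaled] using (hasDerivAt_id (x : ℂ)).comp_ofReal
  · have h : HasDerivAt (fun y : ℂ => 4 * a * y) (4 * a) x := by
      simpa using (hasDerivAt_id (x : ℂ)).const_mul (4 * a)
    simp only [sinhScaled, if_neg ha]
    refine (h.csinh.div_const (4 * a)).comp_ofReal.congr_deriv ?_
    field_simp

lemma cosh_sq_sub_sinhScaled_sq (a : ℂ) (x : ℝ) :
    Complex.cosh (4 * a * x) ^ 2 - (4 * a) ^ 2 * sinhScaled a x ^ 2 = 1 := by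
  rcases eq_or_ne a 0 with rfl | ha
  · simp
  · rw [sinhScaled, if_neg ha, ← Complex.cosh_sq_sub_sinh_sq (4 * a * x)]
    field_simp

lemma bonnetG₄_eq (a : ℂ) {x : ℝ} (hx : sinhScaled a x ≠ 0) :
    bonnetG₄ a x = -2 / sinhScaled a x ^ 2 := by
  have h := cosh_sq_sub_sinhScaled_sq a x
  rcases eq_or_ne a 0 with rfl | ha
  · simp [bonnetG₄, sinhScaled]
  · rw [sinhScaled, if_neg ha] at *
    have hs : Complex.sinh (4 * a * x) ≠ 0 := fun h0 => hx (by rw [h0, zero_div])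
    rw [bonnetG₄, if_neg ha]
    field_simp at h ⊢
    linear_combination -h

/-- Parametrization of the conic `β² - l α² = 1`: an ellipse by the argument of `β + iκα`, two lines
for `l = 0`, a hyperbola by `arsinh`. The sign `ε` selects the line or branch, since `cosh` of a
real number is positive. -/
lemma exists_sinhScaled_eq {l α β : ℝ} (h : β ^ 2 - l * α ^ 2 = 1) :
    ∃ (a : ℂ) (t : ℝ) (ε : ℂ), (4 * a) ^ 2 = l ∧ ε ^ 2 = 1 ∧ sinhScaled a t = ε * α ∧
      Complex.cosh (4 * a * t) = ε * β := by
  rcases lt_trichotomy l 0 with hl | rfl | hl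
  · set κ := Real.sqrt (-l) with hκ
    have hκ0 : 0 < κ := Real.sqrt_pos.mpr (by linarith)
    have hκ2 : κ ^ 2 = -l := Real.sq_sqrt (by linarith)
    set w : ℂ := ⟨β, κ * α⟩ with hw
    have hn : ‖w‖ = 1 := by
      rw [Complex.norm_eq_sqrt_sq_add_sq, Real.sqrt_eq_one]
      simp only [hw]
      nlinarith
    have hw0 : w ≠ 0 := by rintro h0; rw [h0, norm_zero] at hn; exact zero_ne_one hn
    have hsin := Complex.sin_arg w
    have hcos := Complex.cos_arg hw0
    rw [hn, div_one] at hsin hcos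
    have ha0 : (κ : ℂ) * Complex.I / 4 ≠ 0 := by
      simp [hκ0.ne', Complex.I_ne_zero]
    have harg : 4 * ((κ : ℂ) * Complex.I / 4) * ((w.arg / κ : ℝ) : ℂ) = w.arg * Complex.I := by
      have : (κ : ℂ) ≠ 0 := by exact_mod_cast hκ0.ne'
      push_cast; field_simp
    refine ⟨κ * Complex.I / 4, w.arg / κ, 1, ?_, by norm_num, ?_, ?_⟩
    · have : (κ : ℂ) ^ 2 = -l := by exact_mod_cast hκ2
      rw [show 4 * ((κ : ℂ) * Complex.I / 4) = κ * Complex.I by ring, mul_pow, Complex.I_sq, this]; ring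
    · rw [sinhScaled, if_neg ha0, harg, Complex.sinh_mul_I, ← Complex.ofReal_sin, hsin]
      have : (κ : ℂ) ≠ 0 := by exact_mod_cast hκ0.ne'
      simp only [hw]
      push_cast
      field_simp [Complex.I_ne_zero]
    · rw [harg, Complex.cosh_mul_I, ← Complex.ofReal_cos, hcos, one_mul]
  · refine ⟨0, β * α, β, by simp, ?_, by simp [sinhScaled], ?_⟩
    · have : β ^ 2 = 1 := by linarith
      exact_mod_cast this
    · have : β * β = 1 := by nlinarith
      simp only [mul_zero, zero_mul, Complex.cosh_zero]
      exact_mod_cast this.symm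
  · set κ := Real.sqrt l with hκ
    have hκ0 : 0 < κ := Real.sqrt_pos.mpr hl
    have hκ2 : κ ^ 2 = l := Real.sq_sqrt hl.le
    obtain ⟨ε, hε, hεβ⟩ : ∃ ε : ℝ, ε ^ 2 = 1 ∧ 0 ≤ ε * β := by
      rcases le_total 0 β with hβ | hβ
      · exact ⟨1, by norm_num, by linarith⟩
      · exact ⟨-1, by norm_num, by linarith⟩
    have hκC : (κ : ℂ) ≠ 0 := by exact_mod_cast hκ0.ne'
    have harg : 4 * ((κ : ℂ) / 4) * ((Real.arsinh (κ * (ε * α)) / κ : ℝ) : ℂ)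
        = (Real.arsinh (κ * (ε * α)) : ℝ) := by
      push_cast; field_simp
    refine ⟨κ / 4, Real.arsinh (κ * (ε * α)) / κ, ε, ?_, by exact_mod_cast hε, ?_, ?_⟩
    · rw [show 4 * ((κ : ℂ) / 4) = κ by ring]; exact_mod_cast hκ2
    · rw [sinhScaled, if_neg (div_ne_zero hκC (by norm_num)), harg, ← Complex.ofReal_sinh,
        Real.sinh_arsinh]
      push_cast
      field_simp
    · rw [harg, ← Complex.ofReal_cosh, Real.cosh_arsinh]
      have : 1 + (κ * (ε * α)) ^ 2 = (ε * β) ^ 2 := by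
        rw [mul_pow, mul_pow, mul_pow, hε, hκ2]; linarith
      rw [this, Real.sqrt_sq hεβ]
      push_cast
      rfl

/-- In the variable `x = X(ξ)`, `dX = b dξ`, a positive solution of `q'² - q q'' = 2 q` is
`(sinh (4 a (x - x₀)) / (4 a))²`. -/
lemma exists_eq_sinhScaled_sq {J : Set ℝ} (hJ : IsOpen J) (hJc : IsPreconnected J)
    {ξ₁ : ℝ} (hξ₁ : ξ₁ ∈ J) {X b q q₁ q₂ q₃ : ℝ → ℝ}
    (hb : ∀ ξ ∈ J, b ξ ≠ 0) (hX : ∀ ξ ∈ J, HasDerivAt X (b ξ) ξ)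
    (hq : ∀ ξ ∈ J, HasDerivAt q (b ξ * q₁ ξ) ξ) (hq₁ : ∀ ξ ∈ J, HasDerivAt q₁ (b ξ * q₂ ξ) ξ)
    (hq₂ : ∀ ξ ∈ J, HasDerivAt q₂ (b ξ * q₃ ξ) ξ) (hpos : ∀ ξ ∈ J, 0 < q ξ)
    (heq : ∀ ξ ∈ J, q₁ ξ ^ 2 - q ξ * q₂ ξ = 2 * q ξ) :
    ∃ (a : ℂ) (x₀ : ℝ), (a ^ 2).im = 0 ∧
      ∀ ξ ∈ J, (q ξ : ℂ) = sinhScaled a (X ξ - x₀) ^ 2 := by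
  have hconst : ∀ {E : Type} [NormedAddCommGroup E] [NormedSpace ℝ E] (f : ℝ → E),
      (∀ ξ ∈ J, HasDerivAt f 0 ξ) → ∀ ξ ∈ J, f ξ = f ξ₁ := fun f hf ξ hξ =>
    hJ.is_const_of_deriv_eq_zero hJc
      (fun y hy => (hf y hy).differentiableAt.differentiableWithinAt)
      (fun y hy => (hf y hy).deriv) hξ hξ₁
  -- The equation differentiated once, which says that `(q₂ - 2)/q` has zero derivative.
  have hthird : ∀ ξ ∈ J, q₁ ξ * q₂ ξ - q ξ * q₃ ξ - 2 * q₁ ξ = 0 := by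
    intro ξ hξ
    have h1 := (((hq₁ ξ hξ).pow 2).sub ((hq ξ hξ).mul (hq₂ ξ hξ))).sub ((hq ξ hξ).const_mul 2)
    have h2 : HasDerivAt (fun _ : ℝ => (0 : ℝ)) 0 ξ := hasDerivAt_const ξ 0
    have h3 := h1.unique (h2.congr_of_eventuallyEq (by
      filter_upwards [hJ.mem_nhds hξ] with y hy
      have := heq y hy
      simp only [Pi.sub_apply, Pi.pow_apply, Pi.mul_apply]
      linarith))
    apply mul_left_cancel₀ (hb ξ hξ)
    push_cast at h3
    linear_combination h3
  obtain ⟨l, hl⟩ : ∃ l : ℝ, ∀ ξ ∈ J, q₂ ξ = 2 + 4 * l * q ξ := by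
    refine ⟨(q₂ ξ₁ - 2) / q ξ₁ / 4, fun ξ hξ => ?_⟩
    have := hconst (fun ξ => (q₂ ξ - 2) / q ξ) (fun ξ hξ => ?_) ξ hξ
    · rw [← this]
      have := (hpos ξ hξ).ne'
      field_simp
      ring
    · refine (((hq₂ ξ hξ).sub_const 2).div (hq ξ hξ) (hpos ξ hξ).ne').congr_deriv ?_
      rw [div_eq_zero_iff]
      left
      linear_combination -b ξ * hthird ξ hξ
  have hfirst : ∀ ξ ∈ J, q₁ ξ ^ 2 = 4 * q ξ * (1 + l * q ξ) := by
    intro ξ hξ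
    have := heq ξ hξ
    rw [hl ξ hξ] at this
    linear_combination this
  let s : ℝ → ℝ := fun ξ => Real.sqrt (q ξ)
  let s₁ : ℝ → ℝ := fun ξ => q₁ ξ / (2 * s ξ)
  have hs0 : ∀ ξ ∈ J, 0 < s ξ := fun ξ hξ => Real.sqrt_pos.mpr (hpos ξ hξ)
  have hs2 : ∀ ξ ∈ J, s ξ ^ 2 = q ξ := fun ξ hξ => Real.sq_sqrt (hpos ξ hξ).le
  have hs : ∀ ξ ∈ J, HasDerivAt s (b ξ * s₁ ξ) ξ := by
    intro ξ hξ
    refine ((hq ξ hξ).sqrt (hpos ξ hξ).ne').congr_deriv ?_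
    simp only [s₁, s]
    ring
  have hs₁ : ∀ ξ ∈ J, HasDerivAt s₁ (b ξ * (l * s ξ)) ξ := by
    intro ξ hξ
    have h0 := (hs0 ξ hξ).ne'
    refine ((hq₁ ξ hξ).div ((hs ξ hξ).const_mul 2) (by simpa using h0)).congr_deriv ?_
    have e1 : q₁ ξ = 2 * s ξ * s₁ ξ := by simp only [s₁]; field_simp
    have e2 := hfirst ξ hξ
    have e3 := hl ξ hξ
    rw [← hs2 ξ hξ] at e2 e3
    rw [e3]
    rw [e1] at e2 ⊢
    clear e1
    generalize s₁ ξ = σ at e2 ⊢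
    generalize s ξ = τ at e2 h0 ⊢
    field_simp
    have e4 : σ ^ 2 = 1 + l * τ ^ 2 := by
      apply mul_left_cancel₀ (mul_ne_zero four_ne_zero (pow_ne_zero 2 h0))
      linear_combination e2
    linear_combination -2 * b ξ * e4
  have hs₁2 : ∀ ξ ∈ J, s₁ ξ ^ 2 - l * s ξ ^ 2 = 1 := by
    intro ξ hξ
    have h0 := (hs0 ξ hξ).ne'
    have e2 := hfirst ξ hξ
    rw [← hs2 ξ hξ] at e2
    have e1 : q₁ ξ = 2 * s ξ * s₁ ξ := by simp only [s₁]; field_simp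
    rw [e1] at e2
    apply mul_left_cancel₀ (mul_ne_zero four_ne_zero (pow_ne_zero 2 h0))
    linear_combination e2
  obtain ⟨a, t, ε, ha, hε, hSt, hCt⟩ := exists_sinhScaled_eq (hs₁2 ξ₁ hξ₁)
  refine ⟨a, X ξ₁ - t, ?_, fun ξ hξ => ?_⟩
  · have : a ^ 2 = ((l / 16 : ℝ) : ℂ) := by
      push_cast; rw [← ha]; ring
    rw [this, Complex.ofReal_im]
  · let S : ℝ → ℂ := fun ξ => sinhScaled a (X ξ - (X ξ₁ - t))
    let K : ℝ → ℂ := fun ξ => Complex.cosh (4 * a * ((X ξ - (X ξ₁ - t) : ℝ) : ℂ))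
    have hS : ∀ ξ ∈ J, HasDerivAt S (b ξ * K ξ) ξ := by
      intro ξ hξ
      have := (hasDerivAt_sinhScaled a (X ξ - (X ξ₁ - t))).scomp ξ ((hX ξ hξ).sub_const (X ξ₁ - t))
      simpa [S, K, Function.comp_def] using this
    have hK : ∀ ξ ∈ J, HasDerivAt K (b ξ * (l * S ξ)) ξ := by
      intro ξ hξ
      have := (hasDerivAt_cosh_mul a (X ξ - (X ξ₁ - t))).scomp ξ ((hX ξ hξ).sub_const (X ξ₁ - t))
      rw [ha] at this
      simpa [S, K, Function.comp_def] using this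
    have hKS : ∀ ξ, K ξ ^ 2 - l * S ξ ^ 2 = 1 := by
      intro ξ
      have := cosh_sq_sub_sinhScaled_sq a (X ξ - (X ξ₁ - t))
      rwa [ha] at this
    have hS₁ : S ξ₁ = ε * s ξ₁ := by simpa [S] using hSt
    have hK₁ : K ξ₁ = ε * s₁ ξ₁ := by simpa [K] using hCt
    have hsC : ∀ ξ ∈ J, HasDerivAt (fun ξ => (s ξ : ℂ)) (b ξ * s₁ ξ : ℝ) ξ :=
      fun ξ hξ => (hs ξ hξ).ofReal_comp
    have hs₁C : ∀ ξ ∈ J, HasDerivAt (fun ξ => (s₁ ξ : ℂ)) (b ξ * (l * s ξ) : ℝ) ξ :=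
      fun ξ hξ => (hs₁ ξ hξ).ofReal_comp
    -- The pairs `(s, s₁)` and `(S, K)` solve the same linear system, so these two
    -- subtraction-formula expressions are constant. Their values at `ξ₁` are `0` and `ε`, and `K² -
    -- l S² = 1` then gives `s = ε S`.
    have hA := hconst (fun ξ => (s ξ : ℂ) * K ξ - s₁ ξ * S ξ) (fun ξ hξ => by
      refine (((hsC ξ hξ).mul (hK ξ hξ)).sub ((hs₁C ξ hξ).mul (hS ξ hξ))).congr_deriv ?_
      push_cast; ring) ξ hξ
    have hB := hconst (fun ξ => (s₁ ξ : ℂ) * K ξ - l * (s ξ * S ξ)) (fun ξ hξ => by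
      refine (((hs₁C ξ hξ).mul (hK ξ hξ)).sub
        (((hsC ξ hξ).mul (hS ξ hξ)).const_mul (l : ℂ))).congr_deriv ?_
      push_cast; ring) ξ hξ
    have h1 : (s₁ ξ₁ : ℂ) ^ 2 - l * s ξ₁ ^ 2 = 1 := by exact_mod_cast hs₁2 ξ₁ hξ₁
    simp only [hS₁, hK₁] at hA hB
    have hsS : (s ξ : ℂ) = ε * S ξ := by
      linear_combination (-(s ξ : ℂ)) * hKS ξ + K ξ * hA + S ξ * hB + ε * S ξ * h1
    rw [← hs2 ξ hξ, Complex.ofReal_pow, hsS, mul_pow, hε, one_mul]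

/-! ### The Painlevé test in terms of derivatives of the coefficients -/

/-- Taylor series as a formal power series. -/
def taylorPowerSeries (F : ℝ → ℝ) (ξ₀ : ℝ) : ℂ⟦X⟧ :=
  PowerSeries.mk fun n => ((iteratedDeriv n F ξ₀ / (n.factorial : ℝ) : ℝ) : ℂ)

lemma constantCoeff_taylor (F : ℝ → ℝ) (ξ₀ : ℝ) :
    PowerSeries.constantCoeff (taylorPowerSeries F ξ₀) = F ξ₀ := by
  rw [← PowerSeries.coeff_zero_eq_constantCoeff_apply]
  simp [taylorPowerSeries]

lemma coeff_one_taylor (F : ℝ → ℝ) (ξ₀ : ℝ) :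
    PowerSeries.coeff 1 (taylorPowerSeries F ξ₀) = (deriv F ξ₀ : ℝ) := by
  simp [taylorPowerSeries]

lemma coeff_two_taylor (F : ℝ → ℝ) (ξ₀ : ℝ) :
    PowerSeries.coeff 2 (taylorPowerSeries F ξ₀) = (deriv (deriv F) ξ₀ / 2 : ℝ) := by
  simp [taylorPowerSeries, iteratedDeriv_succ]

lemma isLaurentSolution_iff (C : ℝ) (F₁ F₂ F₃ F₄ : ℝ → ℝ) (ξ₀ : ℝ) (h : ℂ⸨X⸩) :
    IsLaurentSolution C F₁ F₂ F₃ F₄ ξ₀ h ↔ SolvesReduced C (taylorPowerSeries F₁ ξ₀)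
      (taylorPowerSeries F₂ ξ₀) (taylorPowerSeries F₃ ξ₀) (taylorPowerSeries F₄ ξ₀) h :=
  Iff.rfl

/-- Compatibility condition at a double zero of `h'`, in terms of derivatives. -/
def ZeroCondition (F₂ F₃ F₄ : ℝ → ℝ) (ξ : ℝ) : Prop :=
  2 * F₂ ξ ^ 2 * F₃ ξ ^ 2 + F₂ ξ * deriv F₃ ξ * F₃ ξ - deriv F₃ ξ ^ 2
    + 2 * deriv F₂ ξ * F₃ ξ ^ 2 + deriv (deriv F₃) ξ * F₃ ξ + F₄ ξ * F₃ ξ ^ 2 = 0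

lemma passesPainleveTest_iff (C : ℝ) {F₁ F₂ F₃ F₄ : ℝ → ℝ} {J : Set ℝ}
    (h₁ : ∀ ξ ∈ J, F₁ ξ ≠ 0) (h₃ : ∀ ξ ∈ J, F₃ ξ ≠ 0) :
    PassesPainleveTest C F₁ F₂ F₃ F₄ J ↔ ∀ ξ ∈ J,
      (deriv F₁ ξ = -(F₁ ξ * F₂ ξ) ∧
        F₁ ξ * F₄ ξ = deriv (deriv F₁) ξ + 2 * F₁ ξ * deriv F₂ ξ + 2 * F₃ ξ) ∧
      ZeroCondition F₂ F₃ F₄ ξ := by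
  have hp : ∀ ξ, PoleCompatible (taylorPowerSeries F₁ ξ) (taylorPowerSeries F₂ ξ)
      (taylorPowerSeries F₃ ξ) (taylorPowerSeries F₄ ξ) ↔ (deriv F₁ ξ = -(F₁ ξ * F₂ ξ) ∧
        F₁ ξ * F₄ ξ = deriv (deriv F₁) ξ + 2 * F₁ ξ * deriv F₂ ξ + 2 * F₃ ξ) := by
    intro ξ
    simp only [PoleCompatible, constantCoeff_taylor, coeff_one_taylor, coeff_two_taylor]
    norm_cast
    rw [show 2 * (deriv (deriv F₁) ξ / 2 + F₁ ξ * deriv F₂ ξ + F₃ ξ) =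
      deriv (deriv F₁) ξ + 2 * F₁ ξ * deriv F₂ ξ + 2 * F₃ ξ by ring]
  have hz : ∀ ξ, ZeroCompatible (taylorPowerSeries F₂ ξ)
      (taylorPowerSeries F₃ ξ) (taylorPowerSeries F₄ ξ) ↔ ZeroCondition F₂ F₃ F₄ ξ := by
    intro ξ
    simp only [ZeroCompatible, ZeroCondition, constantCoeff_taylor, coeff_one_taylor,
      coeff_two_taylor]
    norm_cast
    rw [mul_div_cancel₀ _ (two_ne_zero' ℝ)]
  refine forall₂_congr fun ξ hξ => ?_
  rw [← hp, ← hz]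
  simp only [isLaurentSolution_iff]
  constructor
  · rintro ⟨hi, hii⟩
    -- The choice of constants is immaterial: the compatibility conditions do not contain them.
    obtain ⟨h, hs, ho, -⟩ := hi 0 0
    obtain ⟨h', hs', ho', -⟩ := hii 1 0 one_ne_zero
    exact ⟨hs.poleCompatible ho, hs'.zeroCompatible ho'⟩
  · rintro ⟨hpc, hzc⟩
    exact ⟨exists_pole_solution C (by rw [constantCoeff_taylor]; exact_mod_cast h₁ ξ hξ) hpc,
      fun g₀ g₂ hg₀ => exists_zero_solution C
        (by rw [constantCoeff_taylor]; exact_mod_cast h₃ ξ hξ) hzc hg₀ g₂⟩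

/-! ### Smooth functions on an open subset of the line -/

lemma contDiffOn_deriv {E : Type*} [NormedAddCommGroup E] [NormedSpace ℝ E] {J : Set ℝ}
    (hJ : IsOpen J) {F : ℝ → E} (hF : ContDiffOn ℝ ∞ F J) : ContDiffOn ℝ ∞ (deriv F) J :=
  hF.deriv_of_isOpen hJ (by simp)

lemma hasDerivAt_of_contDiffOn {E : Type*} [NormedAddCommGroup E] [NormedSpace ℝ E] {J : Set ℝ}
    (hJ : IsOpen J) {F : ℝ → E} (hF : ContDiffOn ℝ ∞ F J) {ξ : ℝ} (hξ : ξ ∈ J) :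
    HasDerivAt F (deriv F ξ) ξ :=
  ((hF.contDiffAt (hJ.mem_nhds hξ)).differentiableAt (by simp)).hasDerivAt

lemma deriv_logDeriv {J : Set ℝ} (hJ : IsOpen J) {F : ℝ → ℝ} (hF : ContDiffOn ℝ ∞ F J) {ξ : ℝ}
    (hξ : ξ ∈ J) (h0 : F ξ ≠ 0) :
    deriv (logDeriv F) ξ = (deriv (deriv F) ξ * F ξ - deriv F ξ ^ 2) / F ξ ^ 2 := by
  have h := (hasDerivAt_of_contDiffOn hJ (contDiffOn_deriv hJ hF) hξ).div
    (hasDerivAt_of_contDiffOn hJ hF hξ) h0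
  rw [show logDeriv F = deriv F / F from rfl, h.deriv, pow_two (deriv F ξ)]

lemma G₄_eq {J : Set ℝ} (hJ : IsOpen J) {F₁ : ℝ → ℝ} (F₄ : ℝ → ℝ) (hF : ContDiffOn ℝ ∞ F₁ J)
    {ξ : ℝ} (hξ : ξ ∈ J) (h0 : F₁ ξ ≠ 0) :
    F₁ ξ ^ 2 * (F₁ ξ ^ 2 * G₄ F₁ F₄ ξ) =
      4 * (F₄ ξ * F₁ ξ ^ 2 + deriv (deriv F₁) ξ * F₁ ξ - 2 * deriv F₁ ξ ^ 2) := by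
  rw [G₄, deriv_logDeriv hJ hF hξ h0, logDeriv_apply]
  field_simp
  ring

/-- The conditions at simple poles of `h` are the conditions on `F₂` and `F₃`. -/
lemma poleCondition_iff {J : Set ℝ} (hJ : IsOpen J) {F₁ F₂ F₃ F₄ : ℝ → ℝ}
    (hF₁ : ContDiffOn ℝ ∞ F₁ J) (h₁ : ∀ ξ ∈ J, F₁ ξ ≠ 0) :
    (∀ ξ ∈ J, deriv F₁ ξ = -(F₁ ξ * F₂ ξ) ∧
        F₁ ξ * F₄ ξ = deriv (deriv F₁) ξ + 2 * F₁ ξ * deriv F₂ ξ + 2 * F₃ ξ) ↔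
      ∀ ξ ∈ J, F₂ ξ = -(deriv F₁ ξ / F₁ ξ) ∧ F₃ ξ = (F₁ ξ / 2) ^ 3 * G₄ F₁ F₄ ξ := by
  have hiff : ∀ ξ ∈ J, (deriv F₁ ξ = -(F₁ ξ * F₂ ξ) ↔ F₂ ξ = -(deriv F₁ ξ / F₁ ξ)) := by
    intro ξ hξ
    have := h₁ ξ hξ
    constructor
    · intro h; rw [h]; field_simp
    · intro h; rw [h]; field_simp
  -- The relation for `F₂` holds on all of the open set `J` and may be differentiated; this removes
  -- `F₂'` from the second condition.
  have hd : (∀ ξ ∈ J, F₂ ξ = -(deriv F₁ ξ / F₁ ξ)) → ∀ ξ ∈ J,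
      deriv F₂ ξ * F₁ ξ ^ 2 = -(deriv (deriv F₁) ξ * F₁ ξ - deriv F₁ ξ ^ 2) := by
    intro h ξ hξ
    have h0 := h₁ ξ hξ
    have : F₂ =ᶠ[nhds ξ] fun y => -(logDeriv F₁ y) := by
      filter_upwards [hJ.mem_nhds hξ] with y hy using h y hy
    rw [this.deriv_eq, deriv.fun_neg, deriv_logDeriv hJ hF₁ hξ h0]
    field_simp
  constructor
  · intro h ξ hξ
    have h0 := h₁ ξ hξ
    have hF₂ := (hiff ξ hξ).mp (h ξ hξ).1
    refine ⟨hF₂, ?_⟩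
    have e1 := hd (fun y hy => (hiff y hy).mp (h y hy).1) ξ hξ
    have e2 := (h ξ hξ).2
    have e3 := G₄_eq hJ F₄ hF₁ hξ h0
    apply mul_left_cancel₀ h0
    linear_combination (-1/8) * e3 - F₁ ξ / 2 * e2 - e1
  · intro h ξ hξ
    have h0 := h₁ ξ hξ
    refine ⟨(hiff ξ hξ).mpr (h ξ hξ).1, ?_⟩
    have e1 := hd (fun y hy => (h y hy).1) ξ hξ
    have e2 := (h ξ hξ).2
    have e3 := G₄_eq hJ F₄ hF₁ hξ h0
    apply mul_left_cancel₀ h0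
    linear_combination (-1/4) * e3 - 2 * F₁ ξ * e2 - 2 * e1

/-- The condition at double zeros of `h'`, for `q = -2 / G₄`. -/
lemma zeroCondition_iff {J : Set ℝ} (hJ : IsOpen J) {F₁ F₂ F₃ F₄ q : ℝ → ℝ}
    (hF₁ : ContDiffOn ℝ ∞ F₁ J) (h₁ : ∀ ξ ∈ J, F₁ ξ ≠ 0)
    (hq : ContDiffOn ℝ ∞ q J) (hq0 : ∀ ξ ∈ J, q ξ ≠ 0)
    (h₂ : ∀ ξ ∈ J, F₂ ξ = -(deriv F₁ ξ / F₁ ξ)) (h₃ : ∀ ξ ∈ J, F₃ ξ = (F₁ ξ / 2) ^ 3 * G₄ F₁ F₄ ξ)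
    (hG : ∀ ξ ∈ J, G₄ F₁ F₄ ξ = -2 / q ξ) {ξ : ℝ} (hξ : ξ ∈ J) :
    ZeroCondition F₂ F₃ F₄ ξ ↔
      4 * (deriv q ξ ^ 2 * F₁ ξ - q ξ * (deriv (deriv q) ξ * F₁ ξ - deriv q ξ * deriv F₁ ξ))
        = 2 * q ξ * F₁ ξ ^ 3 := by
  have h0 := h₁ ξ hξ
  have hq0' := hq0 ξ hξ
  have dF := fun y (hy : y ∈ J) => hasDerivAt_of_contDiffOn hJ hF₁ hy
  have ddF := hasDerivAt_of_contDiffOn hJ (contDiffOn_deriv hJ hF₁) hξ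
  have dq := fun y (hy : y ∈ J) => hasDerivAt_of_contDiffOn hJ hq hy
  have ddq := hasDerivAt_of_contDiffOn hJ (contDiffOn_deriv hJ hq) hξ
  have eF₃ : ∀ y ∈ J, F₃ y = -(F₁ y ^ 3 / q y) / 4 := by
    intro y hy
    rw [h₃ y hy, hG y hy]; ring
  have eF₂' : deriv F₂ ξ = -((deriv (deriv F₁) ξ * F₁ ξ - deriv F₁ ξ ^ 2) / F₁ ξ ^ 2) := by
    have : F₂ =ᶠ[nhds ξ] fun y => -(logDeriv F₁ y) := by
      filter_upwards [hJ.mem_nhds hξ] with y hy using h₂ y hy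
    rw [this.deriv_eq, deriv.fun_neg, deriv_logDeriv hJ hF₁ hξ h0]
  have eF₃' : ∀ y ∈ J, deriv F₃ y =
      -((3 * F₁ y ^ 2 * deriv F₁ y * q y - F₁ y ^ 3 * deriv q y) / q y ^ 2) / 4 := by
    intro y hy
    have : F₃ =ᶠ[nhds y] fun y => -(F₁ y ^ 3 / q y) / 4 := by
      filter_upwards [hJ.mem_nhds hy] with z hz using eF₃ z hz
    rw [this.deriv_eq, ((((dF y hy).fun_pow 3).fun_div (dq y hy) (hq0 y hy)).fun_neg.div_const 4).deriv]
    norm_num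
  have eF₃'' : deriv (deriv F₃) ξ = -(((6 * F₁ ξ * deriv F₁ ξ ^ 2 * q ξ
      + 3 * F₁ ξ ^ 2 * deriv (deriv F₁) ξ * q ξ - F₁ ξ ^ 3 * deriv (deriv q) ξ) * q ξ ^ 2
      - (3 * F₁ ξ ^ 2 * deriv F₁ ξ * q ξ - F₁ ξ ^ 3 * deriv q ξ) * (2 * q ξ * deriv q ξ))
        / (q ξ ^ 2) ^ 2) / 4 := by
    have : deriv F₃ =ᶠ[nhds ξ] fun y =>
        -((3 * F₁ y ^ 2 * deriv F₁ y * q y - F₁ y ^ 3 * deriv q y) / q y ^ 2) / 4 := by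
      filter_upwards [hJ.mem_nhds hξ] with z hz using eF₃' z hz
    rw [this.deriv_eq]
    refine ((((((((dF ξ hξ).fun_pow 2).const_mul 3).fun_mul ddF).fun_mul (dq ξ hξ)).fun_sub
      (((dF ξ hξ).fun_pow 3).fun_mul ddq)).fun_div ((dq ξ hξ).fun_pow 2)
        (pow_ne_zero 2 hq0')).fun_neg.div_const 4).deriv.trans ?_
    norm_num
    ring
  have eF₄ : F₄ ξ = (-(F₁ ξ ^ 4) / (2 * q ξ) - deriv (deriv F₁) ξ * F₁ ξ
      + 2 * deriv F₁ ξ ^ 2) / F₁ ξ ^ 2 := by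
    have e3 := G₄_eq hJ F₄ hF₁ hξ h0
    rw [hG ξ hξ] at e3
    rw [eq_div_iff (pow_ne_zero 2 h0)]
    have e4 : F₁ ξ ^ 2 * (F₁ ξ ^ 2 * (-2 / q ξ)) = 4 * (-(F₁ ξ ^ 4) / (2 * q ξ)) := by
      field_simp; ring
    linear_combination (-1/4) * e3 + (1/4) * e4
  rw [ZeroCondition, h₂ ξ hξ, eF₂', eF₃ ξ hξ, eF₃' ξ hξ, eF₃'', eF₄, ← sub_eq_zero (b := 2 * q ξ * F₁ ξ ^ 3)]
  generalize deriv (deriv q) ξ = q2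
  generalize deriv q ξ = q1
  generalize deriv (deriv F₁) ξ = f2
  generalize deriv F₁ ξ = f1
  generalize F₁ ξ = f at *
  generalize q ξ = r at *
  -- The condition is a nonzero multiple of `q_x² - q q_xx - 2q`, times `F₁³`, with `d/dx = (2/F₁)
  -- d/dξ`.
  have key : 2 * (-(f1 / f)) ^ 2 * (-(f ^ 3 / r) / 4) ^ 2 +
      -(f1 / f) * (-((3 * f ^ 2 * f1 * r - f ^ 3 * q1) / r ^ 2) / 4) * (-(f ^ 3 / r) / 4) -
      (-((3 * f ^ 2 * f1 * r - f ^ 3 * q1) / r ^ 2) / 4) ^ 2 +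
      2 * -((f2 * f - f1 ^ 2) / f ^ 2) * (-(f ^ 3 / r) / 4) ^ 2 +
      -(((6 * f * f1 ^ 2 * r + 3 * f ^ 2 * f2 * r - f ^ 3 * q2) * r ^ 2 -
        (3 * f ^ 2 * f1 * r - f ^ 3 * q1) * (2 * r * q1)) / (r ^ 2) ^ 2) / 4 * (-(f ^ 3 / r) / 4) +
      (-f ^ 4 / (2 * r) - f2 * f + 2 * f1 ^ 2) / f ^ 2 * (-(f ^ 3 / r) / 4) ^ 2 =
      f ^ 5 / (64 * r ^ 4) *
        (4 * (q1 ^ 2 * f - r * (q2 * f - q1 * f1)) - 2 * r * f ^ 3) := by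
    field_simp
    ring
  rw [key, mul_eq_zero, or_iff_right (by positivity)]

/-! ### The change of independent variable -/

lemma contDiffOn_G₄ {J : Set ℝ} {F₁ F₃ F₄ : ℝ → ℝ} (hF₁ : ContDiffOn ℝ ∞ F₁ J)
    (hF₃ : ContDiffOn ℝ ∞ F₃ J) (h₁ : ∀ ξ ∈ J, F₁ ξ ≠ 0)
    (h₃ : ∀ ξ ∈ J, F₃ ξ = (F₁ ξ / 2) ^ 3 * G₄ F₁ F₄ ξ) : ContDiffOn ℝ ∞ (G₄ F₁ F₄) J := by
  have : ContDiffOn ℝ ∞ (fun ξ => F₃ ξ / (F₁ ξ / 2) ^ 3) J :=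
    hF₃.div ((hF₁.div_const 2).pow 3) fun ξ hξ => pow_ne_zero 3 (div_ne_zero (h₁ ξ hξ) two_ne_zero)
  refine this.congr fun ξ hξ => ?_
  have := h₁ ξ hξ
  rw [h₃ ξ hξ]
  field_simp

lemma G₄_neg {J : Set ℝ} {F₁ F₃ F₄ : ℝ → ℝ} (h₁₃ : ∀ ξ ∈ J, F₁ ξ * F₃ ξ < 0)
    (h₃ : ∀ ξ ∈ J, F₃ ξ = (F₁ ξ / 2) ^ 3 * G₄ F₁ F₄ ξ) : ∀ ξ ∈ J, G₄ F₁ F₄ ξ < 0 := by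
  intro ξ hξ
  have h := h₁₃ ξ hξ
  rw [h₃ ξ hξ] at h
  by_contra hG
  push Not at hG
  have : 0 ≤ F₁ ξ ^ 4 / 8 * G₄ F₁ F₄ ξ := by positivity
  linarith [show F₁ ξ * ((F₁ ξ / 2) ^ 3 * G₄ F₁ F₄ ξ) = F₁ ξ ^ 4 / 8 * G₄ F₁ F₄ ξ by ring]

/-- Where `sinhScaled` is nonzero, `bonnetG₄ = -2 / sinhScaled²`; so the formula for `G₄` says that
`q = -2/G₄` is the square of `sinhScaled`, the general positive solution of `q_x² - q q_xx = 2q`. -/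
lemma zeroCondition_iff_exists {J : Set ℝ} (hJ : IsOpen J) (hJc : IsPreconnected J) {ξ₁ : ℝ}
    (hξ₁ : ξ₁ ∈ J) {F₁ F₂ F₃ F₄ X : ℝ → ℝ} (hF₁ : ContDiffOn ℝ ∞ F₁ J)
    (hF₃ : ContDiffOn ℝ ∞ F₃ J) (h₁ : ∀ ξ ∈ J, F₁ ξ ≠ 0) (h₁₃ : ∀ ξ ∈ J, F₁ ξ * F₃ ξ < 0)
    (h₂ : ∀ ξ ∈ J, F₂ ξ = -(deriv F₁ ξ / F₁ ξ)) (h₃ : ∀ ξ ∈ J, F₃ ξ = (F₁ ξ / 2) ^ 3 * G₄ F₁ F₄ ξ)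
    (hX : ∀ ξ ∈ J, HasDerivAt X (F₁ ξ / 2) ξ) :
    (∀ ξ ∈ J, ZeroCondition F₂ F₃ F₄ ξ) ↔
      ∃ (a : ℂ) (x₀ : ℝ), (a ^ 2).im = 0 ∧ ∀ ξ ∈ J, sinhScaled a (X ξ - x₀) ≠ 0 ∧
        (G₄ F₁ F₄ ξ : ℂ) = bonnetG₄ a (X ξ - x₀) := by
  have hGneg := G₄_neg h₁₃ h₃
  obtain ⟨q, hqdef⟩ : ∃ q : ℝ → ℝ, q = fun ξ => -2 / G₄ F₁ F₄ ξ := ⟨_, rfl⟩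
  have hqpos : ∀ ξ ∈ J, 0 < q ξ := fun ξ hξ => by
    rw [hqdef]; exact div_pos_of_neg_of_neg (by norm_num) (hGneg ξ hξ)
  have hq : ContDiffOn ℝ ∞ q J := by
    rw [hqdef]
    exact contDiffOn_const.div (contDiffOn_G₄ hF₁ hF₃ h₁ h₃) fun ξ hξ => (hGneg ξ hξ).ne
  have hG : ∀ ξ ∈ J, G₄ F₁ F₄ ξ = -2 / q ξ := by
    intro ξ hξ
    have := (hGneg ξ hξ).ne
    simp only [hqdef]
    field_simp
  have hz := fun ξ (hξ : ξ ∈ J) => zeroCondition_iff (F₂ := F₂) (F₃ := F₃) hJ hF₁ h₁ hq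
    (fun ξ hξ => (hqpos ξ hξ).ne') h₂ h₃ hG hξ
  have hq' := contDiffOn_deriv hJ hq
  constructor
  · intro h
    have hb : ContDiffOn ℝ ∞ (fun ξ => F₁ ξ / 2) J := hF₁.div_const 2
    have hb0 : ∀ ξ ∈ J, F₁ ξ / 2 ≠ 0 := fun ξ hξ => div_ne_zero (h₁ ξ hξ) two_ne_zero
    -- Division by `F₁/2` makes `d/dξ` into `d/dx` and preserves smoothness; it is applied three
    -- times.
    have step : ∀ f : ℝ → ℝ, ContDiffOn ℝ ∞ f J →
        ContDiffOn ℝ ∞ (fun ξ => deriv f ξ / (F₁ ξ / 2)) J ∧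
        ∀ ξ ∈ J, HasDerivAt f (F₁ ξ / 2 * (deriv f ξ / (F₁ ξ / 2))) ξ := fun f hf =>
      ⟨(contDiffOn_deriv hJ hf).div hb hb0, fun ξ hξ =>
        (hasDerivAt_of_contDiffOn hJ hf hξ).congr_deriv (mul_div_cancel₀ _ (hb0 ξ hξ)).symm⟩
    obtain ⟨s1, d1⟩ := step q hq
    obtain ⟨s2, d2⟩ := step _ s1
    obtain ⟨s3, d3⟩ := step _ s2
    obtain ⟨a, x₀, ha, hS⟩ := exists_eq_sinhScaled_sq hJ hJc hξ₁ hb0 hX d1 d2 d3 hqpos (by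
      intro ξ hξ
      have h0 := h₁ ξ hξ
      have e := (hz ξ hξ).mp (h ξ hξ)
      have e2 : deriv (fun ξ => deriv q ξ / (F₁ ξ / 2)) ξ =
          (deriv (deriv q) ξ * (F₁ ξ / 2) - deriv q ξ * (deriv F₁ ξ / 2)) / (F₁ ξ / 2) ^ 2 :=
        ((hasDerivAt_of_contDiffOn hJ hq' hξ).fun_div
          ((hasDerivAt_of_contDiffOn hJ hF₁ hξ).div_const 2) (hb0 ξ hξ)).deriv
      rw [e2]
      generalize deriv (deriv q) ξ = q2 at *
      generalize deriv q ξ = q1 at *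
      field_simp
      linear_combination e / 2)
    refine ⟨a, x₀, ha, fun ξ hξ => ?_⟩
    have hS0 : sinhScaled a (X ξ - x₀) ≠ 0 := by
      intro h0
      have := hS ξ hξ
      rw [h0, zero_pow two_ne_zero] at this
      exact (hqpos ξ hξ).ne' (by exact_mod_cast this)
    refine ⟨hS0, ?_⟩
    rw [bonnetG₄_eq a hS0, ← hS ξ hξ, hG ξ hξ]
    push_cast
    rfl
  · rintro ⟨a, x₀, -, h⟩ ξ hξ
    rw [hz ξ hξ]
    let S : ℝ → ℂ := fun ξ => sinhScaled a (X ξ - x₀)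
    let K : ℝ → ℂ := fun ξ => Complex.cosh (4 * a * ((X ξ - x₀ : ℝ) : ℂ))
    have hS : ∀ ξ ∈ J, HasDerivAt S ((F₁ ξ / 2 : ℝ) * K ξ) ξ := by
      intro ξ hξ
      have := (hasDerivAt_sinhScaled a (X ξ - x₀)).scomp ξ ((hX ξ hξ).sub_const x₀)
      simpa [S, K, Function.comp_def] using this
    have hK : ∀ ξ ∈ J, HasDerivAt K ((F₁ ξ / 2 : ℝ) * ((4 * a) ^ 2 * S ξ)) ξ := by
      intro ξ hξ
      have := (hasDerivAt_cosh_mul a (X ξ - x₀)).scomp ξ ((hX ξ hξ).sub_const x₀)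
      simpa [S, K, Function.comp_def] using this
    have hKS : K ξ ^ 2 - (4 * a) ^ 2 * S ξ ^ 2 = 1 := cosh_sq_sub_sinhScaled_sq a (X ξ - x₀)
    have hqS : ∀ ξ ∈ J, (q ξ : ℂ) = S ξ ^ 2 := by
      intro ξ hξ
      obtain ⟨hS0, hb⟩ := h ξ hξ
      simp only [hqdef]
      rw [Complex.ofReal_div, hb, bonnetG₄_eq a hS0]
      push_cast
      field_simp
      rfl
    have hq1 : ∀ ξ ∈ J, ((deriv q ξ : ℝ) : ℂ) = S ξ * K ξ * F₁ ξ := by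
      intro ξ hξ
      have e1 := (hasDerivAt_of_contDiffOn hJ hq hξ).ofReal_comp
      have e2 := ((hS ξ hξ).fun_pow 2).congr_of_eventuallyEq (by
        filter_upwards [hJ.mem_nhds hξ] with y hy using hqS y hy)
      rw [e1.unique e2]
      push_cast
      ring
    have hq2 : ((deriv (deriv q) ξ : ℝ) : ℂ) = F₁ ξ ^ 2 / 2 * (K ξ ^ 2 + (4 * a) ^ 2 * S ξ ^ 2)
        + S ξ * K ξ * (deriv F₁ ξ : ℝ) := by
      have e1 := (hasDerivAt_of_contDiffOn hJ hq' hξ).ofReal_comp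
      have e2 := (((hS ξ hξ).fun_mul (hK ξ hξ)).fun_mul
        (hasDerivAt_of_contDiffOn hJ hF₁ hξ).ofReal_comp).congr_of_eventuallyEq (by
        filter_upwards [hJ.mem_nhds hξ] with y hy using hq1 y hy)
      rw [e1.unique e2]
      push_cast
      ring
    have : ((4 * (deriv q ξ ^ 2 * F₁ ξ - q ξ * (deriv (deriv q) ξ * F₁ ξ
        - deriv q ξ * deriv F₁ ξ)) : ℝ) : ℂ) = (2 * q ξ * F₁ ξ ^ 3 : ℝ) := by
      push_cast
      rw [hq2, hq1 ξ hξ, hqS ξ hξ]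
      linear_combination 2 * S ξ ^ 2 * (F₁ ξ : ℂ) ^ 3 * hKS
    exact_mod_cast this

/-- Since `X' ≠ 0`, a function smooth on `X '' J` is smooth at each `X ξ` in the two-sided sense
required by `deriv`. -/
lemma image_mem_nhds_of_hasDerivAt {J : Set ℝ} (hJ : IsOpen J) {X b : ℝ → ℝ}
    (hb : ContDiffOn ℝ ∞ b J) (hX : ∀ ξ ∈ J, HasDerivAt X (b ξ) ξ) {ξ : ℝ} (hξ : ξ ∈ J)
    (h0 : b ξ ≠ 0) : X '' J ∈ nhds (X ξ) := by
  have hs : HasStrictDerivAt X (b ξ) ξ := by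
    apply hasStrictDerivAt_of_hasDerivAt_of_continuousAt
    · filter_upwards [hJ.mem_nhds hξ] with y hy using hX y hy
    · exact hb.continuousOn.continuousAt (hJ.mem_nhds hξ)
  rw [← hs.map_nhds_eq h0]
  exact Filter.image_mem_map (hJ.mem_nhds hξ)

/-- With `h' = (F₁/2) k'`, the cross terms `±(F₁'/2) k''/k'` from `(log h')''` and `F₂ h''/h'`
cancel. What remains of these two terms, with `F₄`, contains `F₄ + (log F₁)'' - ((log F₁)')² =
(F₁/2)² G₄`, which joins the `F₃` term to form `k' + k² - C`. -/
lemma reducedLHS_comp {C : ℝ} {J : Set ℝ} (hJ : IsOpen J) {F₁ F₂ F₃ F₄ X : ℝ → ℝ}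
    (hF₁ : ContDiffOn ℝ ∞ F₁ J) (h₁ : ∀ ξ ∈ J, F₁ ξ ≠ 0)
    (h₂ : ∀ ξ ∈ J, F₂ ξ = -(deriv F₁ ξ / F₁ ξ)) (h₃ : ∀ ξ ∈ J, F₃ ξ = (F₁ ξ / 2) ^ 3 * G₄ F₁ F₄ ξ)
    (hX : ∀ ξ ∈ J, HasDerivAt X (F₁ ξ / 2) ξ) {a : ℂ} {x₀ : ℝ}
    (hG : ∀ ξ ∈ J, sinhScaled a (X ξ - x₀) ≠ 0 ∧ (G₄ F₁ F₄ ξ : ℂ) = bonnetG₄ a (X ξ - x₀))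
    {k : ℝ → ℂ} (hk : ContDiffOn ℝ 3 k (X '' J)) (hk0 : ∀ x ∈ X '' J, deriv k x ≠ 0)
    {ξ : ℝ} (hξ : ξ ∈ J) :
    reducedLHS C (F₁ ξ) (F₂ ξ) (F₃ ξ) (F₄ ξ) (k ∘ X) ξ
      = ((F₁ ξ : ℂ) / 2) ^ 2 * bonnetLHS C a x₀ k (X ξ) := by
  have hnhds : ∀ y ∈ J, X '' J ∈ nhds (X y) := fun y hy =>
    image_mem_nhds_of_hasDerivAt hJ (hF₁.div_const 2) hX hy (div_ne_zero (h₁ y hy) two_ne_zero)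
  have hkat : ∀ y ∈ J, ContDiffAt ℝ 3 k (X y) := fun y hy => hk.contDiffAt (hnhds y hy)
  have hk'at : ∀ y ∈ J, ContDiffAt ℝ 2 (deriv k) (X y) := fun y hy =>
    (hkat y hy).derivWithin (m := 2) (by norm_num)
  have hdk : ∀ y ∈ J, HasDerivAt (deriv k) (deriv (deriv k) (X y)) (X y) := fun y hy =>
    ((hk'at y hy).differentiableAt (by norm_num)).hasDerivAt
  have hddk : HasDerivAt (deriv (deriv k)) (deriv (deriv (deriv k)) (X ξ)) (X ξ) :=
    (((hk'at ξ hξ).derivWithin (m := 1) (by norm_num)).differentiableAt (by norm_num)).hasDerivAt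
  have hk'0 : ∀ y ∈ J, deriv k (X y) ≠ 0 := fun y hy => hk0 _ ⟨y, hy, rfl⟩
  have hF0 : ∀ y ∈ J, (F₁ y : ℂ) ≠ 0 := fun y hy => by exact_mod_cast h₁ y hy
  have hFd : ∀ y ∈ J, HasDerivAt (fun y => (F₁ y : ℂ)) (deriv F₁ y : ℝ) y := fun y hy =>
    (hasDerivAt_of_contDiffOn hJ hF₁ hy).ofReal_comp
  have hFdd : HasDerivAt (fun y => ((deriv F₁ y : ℝ) : ℂ)) (deriv (deriv F₁) ξ : ℝ) ξ :=
    (hasDerivAt_of_contDiffOn hJ (contDiffOn_deriv hJ hF₁) hξ).ofReal_comp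
  have hd1 : ∀ y ∈ J, deriv (k ∘ X) y = F₁ y / 2 * deriv k (X y) := by
    intro y hy
    rw [(((hkat y hy).differentiableAt (by norm_num)).hasDerivAt.scomp y (hX y hy)).deriv]
    simp
  have hdkX : ∀ y ∈ J,
      HasDerivAt (fun y => deriv k (X y)) (F₁ y / 2 * deriv (deriv k) (X y)) y := by
    intro y hy
    simpa [Function.comp_def] using (hdk y hy).scomp y (hX y hy)
  have hddkX :
      HasDerivAt (fun y => deriv (deriv k) (X y)) (F₁ ξ / 2 * deriv (deriv (deriv k)) (X ξ)) ξ := by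
    simpa [Function.comp_def] using hddk.scomp ξ (hX ξ hξ)
  have hd2 : ∀ y ∈ J, deriv (deriv (k ∘ X)) y =
      (deriv F₁ y : ℝ) / 2 * deriv k (X y) + F₁ y / 2 * (F₁ y / 2 * deriv (deriv k) (X y)) := by
    intro y hy
    have : deriv (k ∘ X) =ᶠ[nhds y] fun y => F₁ y / 2 * deriv k (X y) := by
      filter_upwards [hJ.mem_nhds hy] with z hz using hd1 z hz
    rw [this.deriv_eq, (((hFd y hy).div_const 2).fun_mul (hdkX y hy)).deriv]
  have hL : ∀ y ∈ J, logDeriv (deriv (k ∘ X)) y =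
      (deriv F₁ y : ℝ) / F₁ y + F₁ y / 2 * (deriv (deriv k) (X y) / deriv k (X y)) := by
    intro y hy
    have := hF0 y hy
    have := hk'0 y hy
    rw [logDeriv_apply, hd1 y hy, hd2 y hy]
    field_simp
  have hL' : deriv (logDeriv (deriv (k ∘ X))) ξ =
      ((deriv (deriv F₁) ξ : ℝ) * F₁ ξ - (deriv F₁ ξ : ℝ) * (deriv F₁ ξ : ℝ)) / (F₁ ξ : ℂ) ^ 2
      + ((deriv F₁ ξ : ℝ) / 2 * (deriv (deriv k) (X ξ) / deriv k (X ξ))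
        + F₁ ξ / 2 * ((F₁ ξ / 2 * deriv (deriv (deriv k)) (X ξ) * deriv k (X ξ)
          - deriv (deriv k) (X ξ) * (F₁ ξ / 2 * deriv (deriv k) (X ξ))) / deriv k (X ξ) ^ 2)) := by
    have : logDeriv (deriv (k ∘ X)) =ᶠ[nhds ξ] fun y =>
        (deriv F₁ y : ℝ) / F₁ y + F₁ y / 2 * (deriv (deriv k) (X y) / deriv k (X y)) := by
      filter_upwards [hJ.mem_nhds hξ] with z hz using hL z hz
    rw [this.deriv_eq]
    exact ((hFdd.fun_div (hFd ξ hξ) (hF0 ξ hξ)).fun_add (((hFd ξ hξ).div_const 2).fun_mul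
      (hddkX.fun_div (hdkX ξ hξ) (hk'0 ξ hξ)))).deriv
  have hM : deriv (logDeriv (deriv k)) (X ξ) =
      (deriv (deriv (deriv k)) (X ξ) * deriv k (X ξ)
        - deriv (deriv k) (X ξ) * deriv (deriv k) (X ξ)) / deriv k (X ξ) ^ 2 :=
    (hddk.div (hdk ξ hξ) (hk'0 ξ hξ)).deriv
  obtain ⟨hS0, hGS⟩ := hG ξ hξ
  rw [bonnetG₄_eq a hS0] at hGS
  have hF₄ : (F₁ ξ : ℂ) ^ 2 * ((F₁ ξ : ℂ) ^ 2 * G₄ F₁ F₄ ξ) =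
      4 * (F₄ ξ * F₁ ξ ^ 2 + (deriv (deriv F₁) ξ : ℝ) * F₁ ξ - 2 * (deriv F₁ ξ : ℝ) ^ 2) := by
    exact_mod_cast G₄_eq hJ F₄ hF₁ hξ (h₁ ξ hξ)
  have hF₂ : (F₂ ξ : ℂ) = -((deriv F₁ ξ : ℝ) / F₁ ξ) := by rw [h₂ ξ hξ]; push_cast; rfl
  have hF₃ : (F₃ ξ : ℂ) = (F₁ ξ / 2) ^ 3 * G₄ F₁ F₄ ξ := by rw [h₃ ξ hξ]; push_cast; rfl
  rw [reducedLHS, bonnetLHS, hL', hM, hd1 ξ hξ, hd2 ξ hξ, hF₂, hF₃, Function.comp_apply]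
  have h0 := hF0 ξ hξ
  have hk0 := hk'0 ξ hξ
  have e : (1 / sinhScaled a (X ξ - x₀)) ^ 2 = -(G₄ F₁ F₄ ξ : ℂ) / 2 := by
    rw [hGS]; field_simp
  rw [e]
  have hF₄' : (F₄ ξ : ℂ) = (F₁ ξ : ℂ) ^ 2 * G₄ F₁ F₄ ξ / 4
      - (deriv (deriv F₁) ξ : ℝ) / F₁ ξ + 2 * (deriv F₁ ξ : ℝ) ^ 2 / F₁ ξ ^ 2 := by
    field_simp
    linear_combination -hF₄
  rw [hF₄']
  generalize (G₄ F₁ F₄ ξ : ℂ) = g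
  generalize ((deriv (deriv F₁) ξ : ℝ) : ℂ) = f2
  generalize ((deriv F₁ ξ : ℝ) : ℂ) = f1
  generalize (F₁ ξ : ℂ) = f at *
  generalize deriv (deriv (deriv k)) (X ξ) = k3
  generalize deriv (deriv k) (X ξ) = k2
  generalize deriv k (X ξ) = k1 at *
  field_simp
  ring

/-! ### Wirtinger calculus -/

lemma dz_congr {f g : ℂ → ℂ} {z : ℂ} (h : f =ᶠ[nhds z] g) : dz f z = dz g z := by
  rw [dz, dz, h.fderiv_eq]

lemma dzbar_congr {f g : ℂ → ℂ} {z : ℂ} (h : f =ᶠ[nhds z] g) : dzbar f z = dzbar g z := by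
  rw [dzbar, dzbar, h.fderiv_eq]

lemma dz_mul {f g : ℂ → ℂ} {z : ℂ} (hf : DifferentiableAt ℝ f z) (hg : DifferentiableAt ℝ g z) :
    dz (fun w => f w * g w) z = f z * dz g z + g z * dz f z := by
  rw [dz, dz, dz, fderiv_fun_mul hf hg]
  simp
  ring

lemma dzbar_mul {f g : ℂ → ℂ} {z : ℂ} (hf : DifferentiableAt ℝ f z)
    (hg : DifferentiableAt ℝ g z) :
    dzbar (fun w => f w * g w) z = f z * dzbar g z + g z * dzbar f z := by
  rw [dzbar, dzbar, dzbar, fderiv_fun_mul hf hg]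
  simp
  ring

lemma dz_sub {f g : ℂ → ℂ} {z : ℂ} (hf : DifferentiableAt ℝ f z) (hg : DifferentiableAt ℝ g z) :
    dz (fun w => f w - g w) z = dz f z - dz g z := by
  rw [dz, dz, dz, fderiv_fun_sub hf hg]
  simp
  ring

lemma dz_div {f g : ℂ → ℂ} {z : ℂ} (hf : DifferentiableAt ℝ f z) (hg : DifferentiableAt ℝ g z)
    (h0 : g z ≠ 0) :
    dz (fun w => f w / g w) z = (g z * dz f z - f z * dz g z) / g z ^ 2 := by
  have hdiv : DifferentiableAt ℝ (fun w => f w / g w) z := by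
    simp only [div_eq_mul_inv]
    exact hf.fun_mul (hg.fun_inv h0)
  have hev : f =ᶠ[nhds z] fun w => f w / g w * g w := by
    filter_upwards [hg.continuousAt.eventually_ne h0] with w hw
    exact (div_mul_cancel₀ _ hw).symm
  have h := dz_congr hev
  rw [dz_mul hdiv hg] at h
  rw [h]
  field_simp
  ring

lemma fderiv_comp_real {g : ℝ → ℂ} {φ : ℂ → ℝ} {z : ℂ} (hg : DifferentiableAt ℝ g (φ z))
    (hφ : DifferentiableAt ℝ φ z) (v : ℂ) :
    fderiv ℝ (fun w => g (φ w)) z v = deriv g (φ z) * fderiv ℝ (toC φ) z v := by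
  have h1 := (hg.hasDerivAt.hasFDerivAt.comp z hφ.hasFDerivAt).fderiv
  have h2 : fderiv ℝ (toC φ) z = Complex.ofRealCLM.comp (fderiv ℝ φ z) :=
    (Complex.ofRealCLM.hasFDerivAt.comp z hφ.hasFDerivAt).fderiv
  rw [show (fun w => g (φ w)) = g ∘ φ from rfl, h1, h2]
  simp [mul_comm]

lemma dz_comp_real {g : ℝ → ℂ} {φ : ℂ → ℝ} {z : ℂ} (hg : DifferentiableAt ℝ g (φ z))
    (hφ : DifferentiableAt ℝ φ z) :
    dz (fun w => g (φ w)) z = deriv g (φ z) * dz (toC φ) z := by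
  rw [dz, dz, fderiv_comp_real hg hφ, fderiv_comp_real hg hφ]
  ring

lemma dzbar_comp_real {g : ℝ → ℂ} {φ : ℂ → ℝ} {z : ℂ} (hg : DifferentiableAt ℝ g (φ z))
    (hφ : DifferentiableAt ℝ φ z) :
    dzbar (fun w => g (φ w)) z = deriv g (φ z) * dzbar (toC φ) z := by
  rw [dzbar, dzbar, fderiv_comp_real hg hφ, fderiv_comp_real hg hφ]
  ring

lemma dzbar_toC {φ : ℂ → ℝ} {z : ℂ} (hφ : DifferentiableAt ℝ φ z) :
    dzbar (toC φ) z = star (dz (toC φ) z) := by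
  have h2 : fderiv ℝ (toC φ) z = Complex.ofRealCLM.comp (fderiv ℝ φ z) :=
    (Complex.ofRealCLM.hasFDerivAt.comp z hφ.hasFDerivAt).fderiv
  rw [dz, dzbar, h2]
  simp

lemma contDiffOn_toC {U : Set ℂ} {φ : ℂ → ℝ} (hφ : ContDiffOn ℝ ∞ φ U) :
    ContDiffOn ℝ ∞ (toC φ) U :=
  Complex.ofRealCLM.contDiff.comp_contDiffOn hφ

lemma contDiffOn_fderiv_apply {U : Set ℂ} (hU : IsOpen U) {f : ℂ → ℂ} (hf : ContDiffOn ℝ ∞ f U)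
    (v : ℂ) : ContDiffOn ℝ ∞ (fun z => fderiv ℝ f z v) U :=
  (hf.fderiv_of_isOpen hU (by simp)).clm_apply contDiffOn_const

lemma contDiffOn_dz {U : Set ℂ} (hU : IsOpen U) {f : ℂ → ℂ} (hf : ContDiffOn ℝ ∞ f U) :
    ContDiffOn ℝ ∞ (dz f) U :=
  ((contDiffOn_fderiv_apply hU hf 1).sub
    (contDiffOn_const.mul (contDiffOn_fderiv_apply hU hf Complex.I))).div_const 2

lemma contDiffOn_dzbar {U : Set ℂ} (hU : IsOpen U) {f : ℂ → ℂ} (hf : ContDiffOn ℝ ∞ f U) :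
    ContDiffOn ℝ ∞ (dzbar f) U :=
  ((contDiffOn_fderiv_apply hU hf 1).add
    (contDiffOn_const.mul (contDiffOn_fderiv_apply hU hf Complex.I))).div_const 2

lemma differentiableAt_of_contDiffOn {E F : Type*} [NormedAddCommGroup E] [NormedSpace ℝ E]
    [NormedAddCommGroup F] [NormedSpace ℝ F] {U : Set E} (hU : IsOpen U) {f : E → F}
    (hf : ContDiffOn ℝ ∞ f U) {z : E} (hz : z ∈ U) : DifferentiableAt ℝ f z :=
  (hf.contDiffAt (hU.mem_nhds hz)).differentiableAt (by simp)

lemma dzbar_dz {U : Set ℂ} (hU : IsOpen U) {f : ℂ → ℂ} (hf : ContDiffOn ℝ ∞ f U) {z : ℂ}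
    (hz : z ∈ U) : dzbar (dz f) z = dz (dzbar f) z := by
  have hd : DifferentiableAt ℝ (fderiv ℝ f) z :=
    differentiableAt_of_contDiffOn hU (hf.fderiv_of_isOpen hU (by simp)) hz
  have happ : ∀ v : ℂ, DifferentiableAt ℝ (fun w => fderiv ℝ f w v) z := fun v =>
    hd.clm_apply (differentiableAt_const v)
  have hI : DifferentiableAt ℝ (fun y => Complex.I * fderiv ℝ f y Complex.I) z :=
    (happ _).const_mul _
  have hv : ∀ v w : ℂ, fderiv ℝ (fun y => fderiv ℝ f y v) z w = fderiv ℝ (fderiv ℝ f) z w v := by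
    intro v w
    rw [fderiv_clm_apply hd (differentiableAt_const v)]
    simp
  have hsymm : fderiv ℝ (fderiv ℝ f) z 1 Complex.I = fderiv ℝ (fderiv ℝ f) z Complex.I 1 :=
    ((hf.contDiffAt (hU.mem_nhds hz)).isSymmSndFDerivAt (by
      simp only [minSmoothness_of_isRCLikeNormedField]; exact WithTop.coe_le_coe.mpr (le_top : (2 : ℕ∞) ≤ ⊤))).eq 1 Complex.I
  have h1 : ∀ w, fderiv ℝ (dz f) z w = (fderiv ℝ (fderiv ℝ f) z w 1
      - Complex.I * fderiv ℝ (fderiv ℝ f) z w Complex.I) / 2 := by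
    intro w
    have : dz f = fun y => (fderiv ℝ f y 1 - Complex.I * fderiv ℝ f y Complex.I) * 2⁻¹ := rfl
    rw [this, fderiv_mul_const ((happ 1).fun_sub hI),
      fderiv_fun_sub (happ 1) hI, fderiv_const_mul (happ _)]
    simp [hv]
    ring
  have h2 : ∀ w, fderiv ℝ (dzbar f) z w = (fderiv ℝ (fderiv ℝ f) z w 1
      + Complex.I * fderiv ℝ (fderiv ℝ f) z w Complex.I) / 2 := by
    intro w
    have : dzbar f = fun y => (fderiv ℝ f y 1 + Complex.I * fderiv ℝ f y Complex.I) * 2⁻¹ := rfl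
    rw [this, fderiv_mul_const ((happ 1).fun_add hI),
      fderiv_fun_add (happ 1) hI, fderiv_const_mul (happ _)]
    simp [hv]
    ring
  rw [dzbar, dz, h1, h1, h2, h2, hsymm]
  ring

/-! ### Reduction of the Gauss-Codazzi equations -/

/-- A nonzero differential with values in `ℝ` is surjective, so `φ` is an open map on `U`. -/
lemma isOpen_image_of_dz_ne_zero {U : Set ℂ} (hU : IsOpen U) {φ : ℂ → ℝ}
    (hφ : ContDiffOn ℝ ∞ φ U) (hφ0 : ∀ z ∈ U, dz (toC φ) z ≠ 0) : IsOpen (φ '' U) := by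
  rw [isOpen_iff_mem_nhds]
  rintro _ ⟨z, hz, rfl⟩
  have hs := (hφ.contDiffAt (hU.mem_nhds hz)).hasStrictFDerivAt (by simp)
  have hne : fderiv ℝ φ z ≠ 0 := by
    intro h0
    apply hφ0 z hz
    have h2 : fderiv ℝ (toC φ) z = Complex.ofRealCLM.comp (fderiv ℝ φ z) :=
      (Complex.ofRealCLM.hasFDerivAt.comp z hs.hasFDerivAt).fderiv
    simp [dz, h2, h0]
  have hsurj : (fderiv ℝ φ z).range = ⊤ := by
    rw [LinearMap.range_eq_top]
    exact LinearMap.surjective (fun h => hne (ContinuousLinearMap.coe_injective h))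
  rw [← hs.map_nhds_eq_of_surj hsurj]
  exact Filter.image_mem_map (hU.mem_nhds hz)

lemma hasDerivAt_toC {h : ℝ → ℝ} {ξ : ℝ} (hh : DifferentiableAt ℝ h ξ) :
    HasDerivAt (toC h) (deriv h ξ : ℝ) ξ := hh.hasDerivAt.ofReal_comp

section Reduction

variable {C : ℝ} {U : Set ℂ} {υ φ : ℂ → ℝ} {Q : ℂ → ℂ} {h : ℝ → ℝ}

lemma dzbar_toC_ne_zero (hU : IsOpen U) (hφ : ContDiffOn ℝ ∞ φ U)
    (hφ0 : ∀ z ∈ U, dz (toC φ) z ≠ 0) {z : ℂ} (hz : z ∈ U) : dzbar (toC φ) z ≠ 0 := by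
  rw [dzbar_toC (differentiableAt_of_contDiffOn hU hφ hz)]
  simpa using hφ0 z hz

variable (hU : IsOpen U) (hφ : ContDiffOn ℝ ∞ φ U) (hh : ContDiffOn ℝ ∞ h (φ '' U))
  (hφ0 : ∀ z ∈ U, dz (toC φ) z ≠ 0) (hGC : GaussCodazzi C υ (h ∘ φ) Q U)

include hU hφ hh hφ0 hGC

lemma dzbar_hopf {z : ℂ} (hz : z ∈ U) :
    dzbar Q z = deriv (toC h) (φ z) * dz (toC φ) z * Complex.exp (υ z) / 2 := by
  have hJ := isOpen_image_of_dz_ne_zero hU hφ hφ0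
  have hd := (hasDerivAt_toC
    (differentiableAt_of_contDiffOn hJ hh ⟨z, hz, rfl⟩)).differentiableAt
  have h1 := hGC.codazzi₁ z hz
  rw [show toC (h ∘ φ) = fun w => toC h (φ w) from rfl,
    dz_comp_real hd (differentiableAt_of_contDiffOn hU hφ hz)] at h1
  linear_combination h1

lemma dz_star_hopf {z : ℂ} (hz : z ∈ U) :
    dz (fun w => star (Q w)) z =
      deriv (toC h) (φ z) * dzbar (toC φ) z * Complex.exp (υ z) / 2 := by
  have hJ := isOpen_image_of_dz_ne_zero hU hφ hφ0
  have hd := (hasDerivAt_toC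
    (differentiableAt_of_contDiffOn hJ hh ⟨z, hz, rfl⟩)).differentiableAt
  have h1 := hGC.codazzi₂ z hz
  rw [show toC (h ∘ φ) = fun w => toC h (φ w) from rfl,
    dzbar_comp_real hd (differentiableAt_of_contDiffOn hU hφ hz)] at h1
  linear_combination h1

lemma dzbar_hopf_ne_zero (hh0 : ∀ ξ ∈ φ '' U, deriv h ξ ≠ 0) {z : ℂ} (hz : z ∈ U) :
    dzbar Q z ≠ 0 := by
  have hJ := isOpen_image_of_dz_ne_zero hU hφ hφ0
  have hzJ : φ z ∈ φ '' U := ⟨z, hz, rfl⟩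
  rw [dzbar_hopf hU hφ hh hφ0 hGC hz,
    (hasDerivAt_toC (differentiableAt_of_contDiffOn hJ hh hzJ)).deriv]
  have := hh0 _ hzJ
  have := hφ0 z hz
  have := Complex.exp_ne_zero (υ z)
  simp_all

/-- The second Codazzi equation. -/
lemma codazzi_reduced {z : ℂ} (hz : z ∈ U) :
    dz (fun w => star (Q w)) z * dz (toC φ) z - dzbar Q z * dzbar (toC φ) z = 0 := by
  rw [dzbar_hopf hU hφ hh hφ0 hGC hz, dz_star_hopf hU hφ hh hφ0 hGC hz]
  ring

/-- The Gauss equation. -/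
lemma gauss_reduced (hυ : ContDiffOn ℝ ∞ υ U) (hQ : ContDiffOn ℝ ∞ Q U)
    (hh0 : ∀ ξ ∈ φ '' U, deriv h ξ ≠ 0) {z : ℂ} (hz : z ∈ U) :
    reducedLHS C (coeffF₁ Q φ z) (coeffF₂ φ z) (coeffF₃ Q φ z) (coeffF₄ Q φ z) (toC h) (φ z)
      = 0 := by
  have hJ := isOpen_image_of_dz_ne_zero hU hφ hφ0
  have hmem : ∀ w ∈ U, φ w ∈ φ '' U := fun w hw => ⟨w, hw, rfl⟩
  have hhC : ContDiffOn ℝ ∞ (toC h) (φ '' U) := Complex.ofRealCLM.contDiff.comp_contDiffOn hh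
  have hA : ContDiffOn ℝ ∞ (deriv (toC h)) (φ '' U) := contDiffOn_deriv hJ hhC
  have hA0 : ∀ ξ ∈ φ '' U, deriv (toC h) ξ ≠ 0 := by
    intro ξ hξ
    rw [(hasDerivAt_toC (differentiableAt_of_contDiffOn hJ hh hξ)).deriv]
    exact_mod_cast hh0 ξ hξ
  have hL : ContDiffOn ℝ ∞ (logDeriv (deriv (toC h))) (φ '' U) :=
    ((contDiffOn_deriv hJ hA).mul (hA.inv hA0)).congr fun y _ => div_eq_mul_inv _ _
  have dφ : ∀ w ∈ U, DifferentiableAt ℝ φ w := fun w hw => differentiableAt_of_contDiffOn hU hφ hw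
  have dυ : ∀ w ∈ U, DifferentiableAt ℝ υ w := fun w hw => differentiableAt_of_contDiffOn hU hυ hw
  have sφ := contDiffOn_toC hφ
  have sφz := contDiffOn_dz hU sφ
  have sφzb := contDiffOn_dzbar hU sφ
  have sφzzb := contDiffOn_dz hU sφzb
  have sQ' := contDiffOn_dzbar hU hQ
  have sQ'' := contDiffOn_dzbar hU sQ'
  have hQ'0 : ∀ w ∈ U, dzbar Q w ≠ 0 := fun w hw => dzbar_hopf_ne_zero hU hφ hh hφ0 hGC hh0 hw
  have dExp : Differentiable ℝ (fun t : ℝ => Complex.exp t) := by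
    fun_prop
  have hExp' : ∀ t, deriv (fun t : ℝ => Complex.exp t) t = Complex.exp t := fun t =>
    (Complex.hasDerivAt_exp (t : ℂ)).comp_ofReal.deriv
  have dE : ∀ w ∈ U, DifferentiableAt ℝ (fun y => Complex.exp (υ y)) w := fun w hw =>
    (dExp (υ w)).comp w (dυ w hw)
  have dAφ : ∀ w ∈ U, DifferentiableAt ℝ (fun y => deriv (toC h) (φ y)) w := fun w hw =>
    (differentiableAt_of_contDiffOn hJ hA (hmem w hw)).comp w (dφ w hw)
  have dLφ : ∀ w ∈ U, DifferentiableAt ℝ (fun y => logDeriv (deriv (toC h)) (φ y)) w :=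
    fun w hw => (differentiableAt_of_contDiffOn hJ hL (hmem w hw)).comp w (dφ w hw)
  -- Logarithmic `z̄`-derivative of `Q_z̄ = h' φ_z e^υ / 2`, with no logarithm of a complex function
  -- taken.
  have hυzb : ∀ w ∈ U, dzbar (toC υ) w = dzbar (dzbar Q) w / dzbar Q w
      - logDeriv (deriv (toC h)) (φ w) * dzbar (toC φ) w
      - dz (dzbar (toC φ)) w / dz (toC φ) w := by
    intro w hw
    have dφz := differentiableAt_of_contDiffOn hU sφz hw
    have hev : dzbar Q =ᶠ[nhds w] fun y =>
        deriv (toC h) (φ y) * (dz (toC φ) y * (Complex.exp (υ y) * (1 / 2 : ℂ))) := by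
      filter_upwards [hU.mem_nhds hw] with y hy
      rw [dzbar_hopf hU hφ hh hφ0 hGC hy]
      ring
    have hc : dzbar (fun _ : ℂ => (1 / 2 : ℂ)) w = 0 := by simp [dzbar]
    have dc : DifferentiableAt ℝ (fun _ : ℂ => (1 / 2 : ℂ)) w := differentiableAt_const _
    have h1 := dzbar_congr hev
    rw [dzbar_mul (dAφ w hw) (dφz.fun_mul ((dE w hw).fun_mul dc)),
      dzbar_mul dφz ((dE w hw).fun_mul dc), dzbar_mul (dE w hw) dc, hc,
      dzbar_comp_real (differentiableAt_of_contDiffOn hJ hA (hmem w hw)) (dφ w hw),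
      dzbar_comp_real (dExp (υ w)) (dυ w hw), hExp', dzbar_dz hU sφ hw] at h1
    rw [h1, dzbar_hopf hU hφ hh hφ0 hGC hw, logDeriv_apply]
    have := hA0 _ (hmem w hw)
    have := hφ0 w hw
    have := Complex.exp_ne_zero (υ w)
    field_simp
    ring
  have hυzzb : dz (dzbar (toC υ)) z =
      (dzbar Q z * dz (dzbar (dzbar Q)) z - dzbar (dzbar Q) z * dz (dzbar Q) z) / dzbar Q z ^ 2
      - (logDeriv (deriv (toC h)) (φ z) * dz (dzbar (toC φ)) z
        + dzbar (toC φ) z * (deriv (logDeriv (deriv (toC h))) (φ z) * dz (toC φ) z))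
      - (dz (toC φ) z * dz (dz (dzbar (toC φ))) z - dz (dzbar (toC φ)) z * dz (dz (toC φ)) z)
        / dz (toC φ) z ^ 2 := by
    have dQ' := differentiableAt_of_contDiffOn hU sQ' hz
    have dQ'' := differentiableAt_of_contDiffOn hU sQ'' hz
    have dφz := differentiableAt_of_contDiffOn hU sφz hz
    have dφzb := differentiableAt_of_contDiffOn hU sφzb hz
    have dφzzb := differentiableAt_of_contDiffOn hU sφzzb hz
    have ddiv : ∀ {f g : ℂ → ℂ}, DifferentiableAt ℝ f z → DifferentiableAt ℝ g z → g z ≠ 0 →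
        DifferentiableAt ℝ (fun w => f w / g w) z := fun hf hg h0 => by
      simp only [div_eq_mul_inv]
      exact hf.fun_mul (hg.fun_inv h0)
    rw [dz_congr (Filter.eventuallyEq_of_mem (hU.mem_nhds hz) hυzb),
      dz_sub ((ddiv dQ'' dQ' (hQ'0 z hz)).fun_sub ((dLφ z hz).fun_mul dφzb))
        (ddiv dφzzb dφz (hφ0 z hz)),
      dz_sub (ddiv dQ'' dQ' (hQ'0 z hz)) ((dLφ z hz).fun_mul dφzb),
      dz_div dQ'' dQ' (hQ'0 z hz), dz_div dφzzb dφz (hφ0 z hz), dz_mul (dLφ z hz) dφzb,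
      dz_comp_real (differentiableAt_of_contDiffOn hJ hL (hmem z hz)) (dφ z hz)]
  have hG := hGC.gauss z hz
  have hE : Complex.exp (υ z) = 2 * dzbar Q z / (deriv (toC h) (φ z) * dz (toC φ) z) := by
    have := hA0 _ (hmem z hz)
    have := hφ0 z hz
    rw [dzbar_hopf hU hφ hh hφ0 hGC hz]
    field_simp
  have hnorm : (‖Q z‖ : ℂ) ^ 2 = Q z * star (Q z) := (Complex.mul_conj' (Q z)).symm
  rw [hυzzb, Complex.exp_neg, hE, hnorm, logDeriv_apply, Function.comp_apply] at hG
  have hA0z := hA0 _ (hmem z hz)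
  have hφz0 := hφ0 z hz
  have hφzb0 := dzbar_toC_ne_zero hU hφ hφ0 hz
  have hQ0 := hQ'0 z hz
  rw [reducedLHS, coeffF₁, coeffF₂, coeffF₃, coeffF₄, show toC h (φ z) = (h (φ z) : ℂ) from rfl]
  generalize star (Q z) = Qs at *
  generalize dz (dzbar (dzbar Q)) z = q3 at *
  generalize dzbar (dzbar Q) z = q2 at *
  generalize dz (dzbar Q) z = q1 at *
  generalize dzbar Q z = q at *
  generalize dz (dz (dzbar (toC φ))) z = p3 at *
  generalize dz (dzbar (toC φ)) z = p2 at *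
  generalize dz (dz (toC φ)) z = p1 at *
  generalize dz (toC φ) z = p at *
  generalize dzbar (toC φ) z = pb at *
  generalize deriv (logDeriv (deriv (toC h))) (φ z) = l at *
  generalize deriv (deriv (toC h)) (φ z) = A1 at *
  generalize deriv (toC h) (φ z) = A at *
  generalize (h (φ z) : ℂ) = H at *
  -- The factor `-φ_z φ_z̄` is the coefficient of `(log h')''` in `υ_zz̄`.
  apply mul_left_cancel₀ (neg_ne_zero.mpr (mul_ne_zero hφz0 hφzb0))
  rw [mul_zero, ← hG]
  field_simp
  ring

end Reduction

/-! ### Nonvanishing and sign of the coefficients -/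

lemma coeffF₁_ne_zero {Q : ℂ → ℂ} {φ : ℂ → ℝ} {z : ℂ} (hQ : Q z ≠ 0) (hQ' : dzbar Q z ≠ 0)
    (hφ : dzbar (toC φ) z ≠ 0) : coeffF₁ Q φ z ≠ 0 := by
  rw [coeffF₁]
  exact div_ne_zero (mul_ne_zero hQ (by simpa using hQ)) (mul_ne_zero hQ' hφ)

/-- The only place where the sign of `F₁ F₃` is seen. It makes `F₃` nonzero, as the double-zero
expansion needs, and `G₄` negative, so that `√(-2/G₄)` is real. -/
lemma coeffF₁_mul_coeffF₃ {Q : ℂ → ℂ} {φ : ℂ → ℝ} {z : ℂ} (hφ : DifferentiableAt ℝ φ z)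
    (hQ' : dzbar Q z ≠ 0) (hφ0 : dz (toC φ) z ≠ 0) :
    coeffF₁ Q φ z * coeffF₃ Q φ z = (-(‖Q z‖ / ‖dz (toC φ) z‖ ^ 2) ^ 2 : ℝ) := by
  have h1 : (‖Q z‖ : ℂ) ^ 2 = Q z * star (Q z) := (Complex.mul_conj' (Q z)).symm
  have h2 : (‖dz (toC φ) z‖ : ℂ) ^ 2 = dz (toC φ) z * star (dz (toC φ) z) :=
    (Complex.mul_conj' _).symm
  have h3 : star (dz (toC φ) z) ≠ 0 := by simpa using hφ0
  push_cast
  rw [coeffF₁, coeffF₃, dzbar_toC hφ, div_pow, h1, h2]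
  field_simp

end BonnetSurface

end

theorem mainTheorem1 (C : ℝ) (U : Set ℂ) (hU : IsOpen U) (hconn : IsConnected U)
    (υ φ : ℂ → ℝ) (Q : ℂ → ℂ) (h : ℝ → ℝ)
    (hυ : ContDiffOn ℝ ∞ υ U) (hφ : ContDiffOn ℝ ∞ φ U) (hQ : ContDiffOn ℝ ∞ Q U)
    (hh : ContDiffOn ℝ ∞ h (φ '' U))
    (hφ0 : ∀ z ∈ U, BonnetSurface.dz (BonnetSurface.toC φ) z ≠ 0)
    (hQ0 : ∀ z ∈ U, Q z ≠ 0)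
    (hh0 : ∀ ξ ∈ φ '' U, deriv h ξ ≠ 0)
    (hGC : BonnetSurface.GaussCodazzi C υ (h ∘ φ) Q U) :
    -- reduction of the second Codazzi equation and of the Gauss equation
    (∀ z ∈ U,
      BonnetSurface.dz (fun w => star (Q w)) z * BonnetSurface.dz (BonnetSurface.toC φ) z
        - BonnetSurface.dzbar Q z * BonnetSurface.dzbar (BonnetSurface.toC φ) z = 0 ∧
      BonnetSurface.reducedLHS C (BonnetSurface.coeffF₁ Q φ z) (BonnetSurface.coeffF₂ φ z)
        (BonnetSurface.coeffF₃ Q φ z) (BonnetSurface.coeffF₄ Q φ z)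
        (BonnetSurface.toC h) (φ z) = 0) ∧
    -- the case where the coefficients are functions of `ξ = φ(z, z̄)`
    ∀ F₁ F₂ F₃ F₄ : ℝ → ℝ,
      ContDiffOn ℝ ∞ F₁ (φ '' U) → ContDiffOn ℝ ∞ F₂ (φ '' U) →
      ContDiffOn ℝ ∞ F₃ (φ '' U) → ContDiffOn ℝ ∞ F₄ (φ '' U) →
      (∀ z ∈ U, BonnetSurface.coeffF₁ Q φ z = F₁ (φ z) ∧ BonnetSurface.coeffF₂ φ z = F₂ (φ z) ∧
        BonnetSurface.coeffF₃ Q φ z = F₃ (φ z) ∧ BonnetSurface.coeffF₄ Q φ z = F₄ (φ z)) →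
      (∀ ξ ∈ φ '' U, F₁ ξ ≠ 0) ∧
      ∀ ξ₁ ∈ φ '' U, ∀ X : ℝ → ℝ, (∀ ξ, X ξ = ∫ t in ξ₁..ξ, F₁ t / 2) →
        (BonnetSurface.PassesPainleveTest C F₁ F₂ F₃ F₄ (φ '' U) ↔
          (∀ ξ ∈ φ '' U, F₂ ξ = -(deriv F₁ ξ / F₁ ξ) ∧
            F₃ ξ = (F₁ ξ / 2) ^ 3 * BonnetSurface.G₄ F₁ F₄ ξ) ∧
          ∃ (a : ℂ) (x₀ : ℝ), (a ^ 2).im = 0 ∧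
            (∀ ξ ∈ φ '' U, BonnetSurface.sinhScaled a (X ξ - x₀) ≠ 0 ∧
              (BonnetSurface.G₄ F₁ F₄ ξ : ℂ) = BonnetSurface.bonnetG₄ a (X ξ - x₀)) ∧
            -- in the variable `x = X ξ` the equation is Bonnet's
            ∀ k : ℝ → ℂ, ContDiffOn ℝ 3 k (X '' (φ '' U)) →
              (∀ x ∈ X '' (φ '' U), deriv k x ≠ 0) → ∀ ξ ∈ φ '' U,
              BonnetSurface.reducedLHS C (F₁ ξ) (F₂ ξ) (F₃ ξ) (F₄ ξ) (k ∘ X) ξ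
                = ((F₁ ξ : ℂ) / 2) ^ 2 * BonnetSurface.bonnetLHS C a x₀ k (X ξ)) := by

  have hJ := BonnetSurface.isOpen_image_of_dz_ne_zero hU hφ hφ0
  have hQ'0 := fun z (hz : z ∈ U) => BonnetSurface.dzbar_hopf_ne_zero hU hφ hh hφ0 hGC hh0 hz
  refine ⟨fun z hz => ⟨BonnetSurface.codazzi_reduced hU hφ hh hφ0 hGC hz,
    BonnetSurface.gauss_reduced hU hφ hh hφ0 hGC hυ hQ hh0 hz⟩, ?_⟩
  intro F₁ F₂ F₃ F₄ hF₁ _ hF₃ _ hF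
  have h₁ : ∀ ξ ∈ φ '' U, F₁ ξ ≠ 0 := by
    rintro _ ⟨z, hz, rfl⟩ h0
    have := BonnetSurface.coeffF₁_ne_zero (hQ0 z hz) (hQ'0 z hz)
      (BonnetSurface.dzbar_toC_ne_zero hU hφ hφ0 hz)
    rw [(hF z hz).1, h0] at this
    exact this Complex.ofReal_zero
  have h₁₃ : ∀ ξ ∈ φ '' U, F₁ ξ * F₃ ξ < 0 := by
    rintro _ ⟨z, hz, rfl⟩
    have h := BonnetSurface.coeffF₁_mul_coeffF₃ (Q := Q)
      (BonnetSurface.differentiableAt_of_contDiffOn hU hφ hz) (hQ'0 z hz) (hφ0 z hz)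
    rw [(hF z hz).1, (hF z hz).2.2.1, ← Complex.ofReal_mul, Complex.ofReal_inj] at h
    rw [h, neg_lt_zero]
    have := norm_pos_iff.mpr (hQ0 z hz)
    have := norm_pos_iff.mpr (hφ0 z hz)
    positivity
  refine ⟨h₁, fun ξ₁ hξ₁ X hX => ?_⟩
  have hJc : IsPreconnected (φ '' U) := hconn.isPreconnected.image φ hφ.continuousOn
  have hb : ContinuousOn (fun t => F₁ t / 2) (φ '' U) := hF₁.continuousOn.div_const 2
  have hX' : ∀ ξ ∈ φ '' U, HasDerivAt X (F₁ ξ / 2) ξ := by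
    intro ξ hξ
    rw [show X = fun ξ => ∫ t in ξ₁..ξ, F₁ t / 2 from funext hX]
    refine intervalIntegral.integral_hasDerivAt_right
      (hb.mono (hJc.ordConnected.uIcc_subset hξ₁ hξ)).intervalIntegrable
      (hb.stronglyMeasurableAtFilter hJ ξ hξ) (hb.continuousAt (hJ.mem_nhds hξ))
  rw [BonnetSurface.passesPainleveTest_iff C h₁
    (fun ξ hξ h0 => (h₁₃ ξ hξ).ne (by rw [h0, mul_zero])), forall₂_and,
    BonnetSurface.poleCondition_iff hJ hF₁ h₁]
  refine and_congr_right fun hrel => ?_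
  have h₂ := fun ξ hξ => (hrel ξ hξ).1
  have h₃ := fun ξ hξ => (hrel ξ hξ).2
  rw [BonnetSurface.zeroCondition_iff_exists hJ hJc hξ₁ hF₁ hF₃ h₁ h₁₃ h₂ h₃ hX']
  constructor
  -- The Bonnet clause follows from the formula for `G₄` with the same `a` and `x₀`, so it can be
  -- added to the existential statement at no cost.
  · rintro ⟨a, x₀, ha, hG⟩
    exact ⟨a, x₀, ha, hG, fun k hk hk0 ξ hξ =>
      BonnetSurface.reducedLHS_comp hJ hF₁ h₁ h₂ h₃ hX' hG hk hk0 hξ⟩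
  · rintro ⟨a, x₀, ha, hG, -⟩
    exact ⟨a, x₀, ha, hG⟩
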